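/- Lemma. Throughout, $\log$ and $\exp$ are natural, $\mathcal X=\{1,\dots,|\mathcal X|\}$ is a finite alphabet, $P_{\boldsymbol x}$ denotes the type (empirical distribution) of a string $\boldsymbol x\in\mathcal X^n$, $\mathcal P_n$ is the set of types of strings of length $n$, $\mathcal T_P=\{\boldsymbol x\in\mathcal X^n: P_{\boldsymbol x}=P\}$, $H(P)=-\sum_a P(a)\log P(a)$, and $\boldsymbol x_P\in\mathcal T_P$ is the nondecreasing string of type $P$. The symmetric group $S_n$ acts on $\mathcal X^n$ by permuting positions, and $S_{\boldsymbol x_P}$ is the isotropy group of $\boldsymbol x_P$. A conditional type of $\boldsymbol y$ given $\boldsymbol x$ is a stochastic matrix $V$ with $V(b|a)P_{\boldsymbol x}(a)=\frac1n|\{i:(x_i,y_i)=(a,b)\}|$ for all $a,b$; $\mathcal T_V(\boldsymbol x)$ is the set of $\boldsymbol y\in\mathcal X^n$ for which $V$ is a conditional type given $\boldsymbol x$, and $\mathcal V(\boldsymbol x,\mathcal X)$ is the set of $V$ for which it is nonempty. Codebooks are multisets of strings; unions, differences and cardinalities count multiplicity. For $P\in\mathcal P_n$, $0<R<H(P)$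 and $\delta>0$, a codebook $\mathcal M$ is a $(P,R,\delta)$-radical spectral expander if there is a multiset $S'$ of elements of $S_n$, invariant under inversion, such that $\mathcal M=\{s(\boldsymbol x_P)\}_{s\in S'}$, $|\mathcal M|=|S'|=\exp(nR+\delta)$ and $\lambda(\Gamma)\le \exp(-nR/2)$. Here $\Gamma$ is the Schreier multigraph on the left cosets $S_n/S_{\boldsymbol x_P}$ with edges $(v,sv)$ for $s\in S'$, and $\lambda(\Gamma)=\max\{\lambda_2,-\lambda_{\min}\}$ for its transition matrix (adjacency matrix divided by $|S'|$) with eigenvalues $1=\lambda_1\ge\lambda_2\ge\dots\ge\lambda_{\min}$. For $P,R,\delta$ as above, let $\mathcal K^1,\dots,\mathcal K^J$ be multisets of $K$ strings each. Their union $\mathcal M=\biguplus_j\mathcal K^j$ is an $(\alpha,\beta)$-setwise $(P,R,\delta)$-good codebook if (1) every element of $\mathcal M$ is in $\mathcal T_P$; (2) $|\mathcal M\setminus\mathcal K^j|=K(J-1)=\exp(nR-\delta)$; (3) for every $j$ there is a sub-multiset $\mathcal L^j\subseteq\mathcal K^j$ with $|\mathcal L^j|\le\alpha K$ such that every $\boldsymbol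 x\in\mathcal K^j\setminus\mathcal L^j$ satisfies $|\mathcal T_V(\boldsymbol x)\cap(\mathcal M\setminus\mathcal K^j)|\le\beta\,|\mathcal T_V(\boldsymbol x)|\,e^{-n(H(P)-R)}$ for all $V\in\mathcal V(\boldsymbol x,\mathcal X)$. Statement. Let $0<R_E<R_B$. There is $N$ (depending only on $\mathcal X$, $R_E$, $R_B$) such that for all $n\ge N$ and every type $P\in\mathcal P_n$ with $R_B<H(P)$ there exist $K_n$, $J_n$ and a $J_n$-tuple $(\mathcal K_n^1,\dots,\mathcal K_n^{J_n})$ of codebooks in $\mathcal X^n$ with $|\mathcal K_n^j|=K_n$ for all $j$, and real numbers $\delta_2$ and $\delta_1'$ with $$\delta_2\le\log(12\,n\log|\mathcal X|),\qquad \log (n+1)^{|\mathcal X|(|\mathcal X|+1)}\le\delta_1'<\log (n+1)^{|\mathcal X|(|\mathcal X|+1)}+\log\tfrac{J_n}{J_n-1},$$ such that every $\mathcal K_n^j$ is a $(P,R_E,\delta_2)$-radical spectral expander and, for every $\epsilon>0$, the union $\biguplus_j\mathcal K_n^j$ is a $(16\epsilon,\epsilon^{-1})$-setwise $(P,R_B,\delta_1')$-good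 codebook. Thus a single family of codebooks serves both secrecy and correctness. (The range of $\delta_1'$ says that $J_n-1$ is the integer part of $\exp(nR_B)\,(n+1)^{-|\mathcal X|(|\mathcal X|+1)}/K_n$.) -/

import Mathlib

/-! ### Strings, types and conditional types -/

/-- The type `P_x` of a string `x` of length `n`: the empirical distribution of its letters. -/
noncomputable def stringType {X : Type*} [DecidableEq X] {n : ℕ} (x : Fin n → X) : X → ℝ :=
  fun a => ((Finset.univ.filter (fun i => x i = a)).card : ℝ) / n

/-- `P` is a type of strings of length `n`, i.e. `P ∈ 𝒫_n`. -/
def IsStringType {X : Type*} [DecidableEq X] (n : ℕ) (P : X → ℝ) : Prop :=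
  ∃ x : Fin n → X, stringType x = P

/-- The type class `T_P`: all strings of length `n` with type `P`. -/
def typeClass {X : Type*} [DecidableEq X] (n : ℕ) (P : X → ℝ) : Set (Fin n → X) :=
  {x | stringType x = P}

/-- The joint type `P_{x,y}` of two strings of the same length. -/
noncomputable def jointType {X Y : Type*} [DecidableEq X] [DecidableEq Y] {n : ℕ}
    (x : Fin n → X) (y : Fin n → Y) : X → Y → ℝ :=
  fun a b => ((Finset.univ.filter (fun i => x i = a ∧ y i = b)).card : ℝ) / n

/-- `T_V(x)`: all strings `y` whose conditional type given `x` is `V`, where `V a b` stands for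
`V(b | a)`. The rows of `V` at letters that do not occur in `x` are irrelevant. -/
def condTypeClass {X Y : Type*} [DecidableEq X] [DecidableEq Y] {n : ℕ}
    (V : X → Y → ℝ) (x : Fin n → X) : Set (Fin n → Y) :=
  {y | ∀ a b, V a b * stringType x a = jointType x y a b}

/-- `𝒱(x, Y)`: the stochastic matrices that are a conditional type given `x` of some string. -/
def condTypes {X : Type*} [DecidableEq X] {n : ℕ} (x : Fin n → X)
    (Y : Type*) [DecidableEq Y] [Fintype Y] : Set (X → Y → ℝ) :=
  {V | (∀ a b, 0 ≤ V a b) ∧ (∀ a, ∑ b, V a b = 1) ∧ (condTypeClass V x).Nonempty}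

/-- The Shannon entropy `H(X)_P = - ∑ P(a) log P(a)`, in nats. -/
noncomputable def shannonEntropy {X : Type*} [Fintype X] (P : X → ℝ) : ℝ :=
  -∑ a, P a * Real.log (P a)

/-- The action of `S_n` on strings of length `n` by permuting the positions. -/
def permuteString {X : Type*} {n : ℕ} (s : Equiv.Perm (Fin n)) (x : Fin n → X) : Fin n → X :=
  fun i => x (s⁻¹ i)

/-- The isotropy group `S_x` of a string `x`. -/
def isotropy {X : Type*} {n : ℕ} (x : Fin n → X) : Subgroup (Equiv.Perm (Fin n)) where
  carrier := {s | permuteString s x = x}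
  one_mem' := by
    funext i
    simp [permuteString]
  mul_mem' := by
    intro s t hs ht
    funext i
    have h1 := congrFun hs i
    have h2 := congrFun ht (s⁻¹ i)
    simp only [permuteString, mul_inv_rev, Equiv.Perm.coe_mul, Function.comp_apply] at h1 h2 ⊢
    rw [h2, h1]
  inv_mem' := by
    intro s hs
    funext i
    have h1 := congrFun hs (s i)
    simp only [permuteString, inv_inv] at h1 ⊢
    rw [← h1]
    simp

/-! ### Schreier graphs -/

/-- A multiset of group elements is symmetric if it is closed under inverses, with multiplicity. -/
def IsSymmetricMultiset {G : Type*} [Group G] (S : Multiset G) : Prop :=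
  S.map (fun s => s⁻¹) = S

open Classical in
/-- The adjacency matrix of the Schreier graph `Γ(G, G/H, S)`: the vertices are the left cosets of
`H`, and there is one edge `(v, s v)` for every vertex `v` and every `s ∈ S`. -/
noncomputable def schreierAdjacency {G : Type*} [Group G] (H : Subgroup G) (S : Multiset G) :
    Matrix (G ⧸ H) (G ⧸ H) ℝ :=
  fun v w => ((S.countP (fun s => s • v = w) : ℕ) : ℝ)

/-- The transition matrix of the random walk on the `|S|`-regular graph `Γ(G, G/H, S)`. -/
noncomputable def schreierTransition {G : Type*} [Group G] (H : Subgroup G) (S : Multiset G) :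
    Matrix (G ⧸ H) (G ⧸ H) ℝ :=
  ((S.card : ℝ)⁻¹) • schreierAdjacency H S

theorem schreierTransition_isHermitian {G : Type*} [Group G] (H : Subgroup G) {S : Multiset G}
    (hS : IsSymmetricMultiset S) : (schreierTransition H S).IsHermitian := by
  classical
  ext v w
  simp only [schreierTransition, schreierAdjacency, Matrix.conjTranspose_apply, Matrix.smul_apply,
    star_trivial, smul_eq_mul]
  congr 2
  conv_lhs => rw [← hS]
  rw [Multiset.countP_map, ← Multiset.countP_eq_card_filter]
  refine Multiset.countP_congr rfl ?_
  intro s _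
  simp only [inv_smul_eq_iff]
  exact propext eq_comm

/-- For a symmetric matrix with eigenvalues `λ₁ ≥ λ₂ ≥ ⋯ ≥ λ_N` (with multiplicity), `N ≥ 2`, the
number `max {λ₂, -λ_N}`. Note that `eigenvalues₀` is sorted in decreasing order. The value `0` for
`N < 2` is a convention. -/
noncomputable def secondEigenvalue {V : Type*} [Fintype V] [DecidableEq V] {A : Matrix V V ℝ}
    (hA : A.IsHermitian) : ℝ :=
  if h : 1 < Fintype.card V then
    max (hA.eigenvalues₀ ⟨1, h⟩) (-hA.eigenvalues₀ ⟨Fintype.card V - 1, by omega⟩)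
  else 0

open Classical in
/-- `λ(Γ(G, G/H, S))` for a symmetric multiset `S`. -/
noncomputable def schreierLambda {G : Type*} [Group G] [Fintype G] (H : Subgroup G)
    {S : Multiset G} (hS : IsSymmetricMultiset S) : ℝ :=
  secondEigenvalue (schreierTransition_isHermitian H hS)

/-! ### Codebooks -/

/-- The codebook `M` (a multiset of strings of length `n`) is a `(P, R, δ)`-radical spectral
expander. The string `xP` in the last field is the nondecreasing string of type `P`, which is
unique: `(1, …, 1, 2, …, 2, …)` with `n P(i)` letters `i`. -/
structure IsRadicalSpectralExpander {X : Type*} [Fintype X] [LinearOrder X] {n : ℕ}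
    (P : X → ℝ) (R δ : ℝ) (M : Multiset (Fin n → X)) : Prop where
  isType : IsStringType n P
  rate_pos : 0 < R
  rate_lt : R < shannonEntropy P
  delta_pos : 0 < δ
  exists_expander : ∃ xP : Fin n → X, Monotone xP ∧ stringType xP = P ∧
    ∃ (S : Multiset (Equiv.Perm (Fin n))) (hS : IsSymmetricMultiset S),
      M = S.map (fun s => permuteString s xP) ∧
      M.card = S.card ∧
      (S.card : ℝ) = Real.exp (n * R + δ) ∧
      schreierLambda (isotropy xP) hS ≤ Real.exp (-(n * R / 2))

open Classical in
/-- The multiset `M = ⨄ j, 𝒦 j` is an `(α, β)`-setwise `(P, R, δ)`-good codebook, for a `J`-tuple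
`𝒦` of multisets of strings of length `n` with `K` elements each. All cardinalities, and the
differences `M - 𝒦 j` and `𝒦 j - L`, are taken with multiplicity. -/
structure IsSetwiseGoodCodebook {X : Type*} [Fintype X] [LinearOrder X] {n : ℕ}
    (α β : ℝ) (P : X → ℝ) (R δ : ℝ) (K J : ℕ) (𝒦 : Fin J → Multiset (Fin n → X)) : Prop where
  isType : IsStringType n P
  rate_pos : 0 < R
  rate_lt : R < shannonEntropy P
  delta_pos : 0 < δ
  card_eq : ∀ j, (𝒦 j).card = K
  mem_typeClass : ∀ x ∈ ∑ l, 𝒦 l, x ∈ typeClass n P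
  card_diff : ∀ j, (((∑ l, 𝒦 l) - 𝒦 j).card : ℝ) = (K : ℝ) * ((J : ℝ) - 1)
  size_eq : (K : ℝ) * ((J : ℝ) - 1) = Real.exp (n * R - δ)
  exists_bad : ∀ j, ∃ L : Multiset (Fin n → X), L ≤ 𝒦 j ∧ (L.card : ℝ) ≤ α * K ∧
    ∀ x ∈ 𝒦 j - L, ∀ V ∈ condTypes x X,
      ((((∑ l, 𝒦 l) - 𝒦 j).countP (fun y => y ∈ condTypeClass V x) : ℕ) : ℝ) ≤
        β * ((condTypeClass V x).ncard : ℝ) * Real.exp (-(n * (shannonEntropy P - R)))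

/-! ### A trace inequality -/

/-! Each codebook comes from a random `k`-tuple of permutations together with their inverses. Two
facts about such tuples are combined: at least half of all tuples expand, and two independent tuples
interfere little on average.

Expansion is a moment bound. With the constants projected out, the transition matrix is `k⁻¹` times
a sum of `k` independent centered symmetric contractions. Resampling one summand gives an
exchangeable pair, and a trace inequality bounds the moment of order `2r + 2` by `(2r + 1) k` times
the moment of order `2r` (`trace_sum_moment_term`, `sum_trace_pow_le`). Markov's inequality with `p`
of order `n log |X|` then shows that at least half of the tuples have second eigenvalue at most `t`,
once `k t²` is at least `4p` (`card_le_two_mul_card_expanding`).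

Interference is measured by one weight that handles all conditional types at once: `invJointCard x
y` is the reciprocal of the size of the conditional type class of `y` given `x`. Summed over all `y`
it counts joint types, so it is at most polynomial. Since a random permutation of `z` is uniform on
a type class of size at least `exp (n H) / (n + 1) ^ |X|`, its expected weight is at most `(n + 1) ^
(|X| (|X| + 1)) exp (-n H)`. Conditioning on expansion costs a factor 2. Drawing about twice as many
codebooks as needed and discarding the worst keeps every remaining row sum within 4 times the mean
(`exists_family_offDiag_le`).

A final Markov bound inside each codebook removes the strings of large total weight; for the others,
the weight bounds the number of competitors in every conditional type class. The family is fixed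
before `ε` enters, so it serves all `ε` simultaneously. -/

theorem Matrix.IsHermitian.exists_pow_eq {V : Type*} [Fintype V] [DecidableEq V]
    {A : Matrix V V ℝ} (hA : A.IsHermitian) (p : ℕ) :
    A ^ p = (hA.eigenvectorUnitary : Matrix V V ℝ) * Matrix.diagonal (fun i => hA.eigenvalues i ^ p)
      * (hA.eigenvectorUnitary : Matrix V V ℝ).transpose := by
  conv_lhs => rw [hA.spectral_theorem, ← map_pow, Matrix.diagonal_pow]
  rw [Unitary.conjStarAlgAut_apply]
  rfl

/-- The coefficients are the squared inner products of the two eigenbases. They form a nonnegative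
joint spectral weight, so trace inequalities in two noncommuting symmetric matrices reduce to
inequalities in two real variables. -/
theorem trace_pow_mul_pow {V : Type*} [Fintype V] [DecidableEq V] {A B : Matrix V V ℝ}
    (hA : A.IsHermitian) (hB : B.IsHermitian) :
    ∃ (a b : V → ℝ) (c : V → V → ℝ), (∀ i j, 0 ≤ c i j) ∧
      ∀ p q : ℕ, (A ^ p * B ^ q).trace = ∑ i, ∑ j, a i ^ p * b j ^ q * c i j := by
  set U : Matrix V V ℝ := (hA.eigenvectorUnitary : Matrix V V ℝ) with hU
  set W : Matrix V V ℝ := (hB.eigenvectorUnitary : Matrix V V ℝ) with hW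
  refine ⟨hA.eigenvalues, hB.eigenvalues, fun i j => ((U.transpose * W) i j) ^ 2,
    fun i j => sq_nonneg _, fun p q => ?_⟩
  rw [hA.exists_pow_eq, hB.exists_pow_eq, ← hU, ← hW]
  have h1 : U * Matrix.diagonal (fun i => hA.eigenvalues i ^ p) * U.transpose *
      (W * Matrix.diagonal (fun i => hB.eigenvalues i ^ q) * W.transpose) =
      U * (Matrix.diagonal (fun i => hA.eigenvalues i ^ p) * (U.transpose * W) *
        Matrix.diagonal (fun i => hB.eigenvalues i ^ q) * W.transpose) := by
    simp only [Matrix.mul_assoc]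
  have h2 : W.transpose * U = (U.transpose * W).transpose := by
    rw [Matrix.transpose_mul, Matrix.transpose_transpose]
  rw [h1, Matrix.trace_mul_comm, Matrix.mul_assoc, h2]
  simp only [Matrix.trace, Matrix.diag, Matrix.mul_apply (M := _ * _ * _),
    Matrix.mul_diagonal, Matrix.diagonal_mul, Matrix.transpose_apply]
  exact Finset.sum_congr rfl fun i _ => Finset.sum_congr rfl fun j _ => by ring

theorem pow_mul_pow_add_le (a b : ℝ) (ha : 0 ≤ a) (hb : 0 ≤ b) (i j : ℕ) :
    a ^ i * b ^ j + a ^ j * b ^ i ≤ a ^ (i + j) + b ^ (i + j) := by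
  have key : 0 ≤ (a ^ i - b ^ i) * (a ^ j - b ^ j) := by
    rcases le_total a b with h | h
    · exact mul_nonneg_of_nonpos_of_nonpos (sub_nonpos.2 (pow_le_pow_left₀ ha h i))
        (sub_nonpos.2 (pow_le_pow_left₀ ha h j))
    · exact mul_nonneg (sub_nonneg.2 (pow_le_pow_left₀ hb h i))
        (sub_nonneg.2 (pow_le_pow_left₀ hb h j))
  rw [pow_add, pow_add]
  nlinarith [key]

/-- After passing to absolute values, the terms are paired with their reflections and
`pow_mul_pow_add_le` is applied to each pair; the total degree `2 * r` is even, so the absolute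
values disappear again. -/
theorem two_mul_geom_sum_le (a b : ℝ) (r : ℕ) :
    2 * ∑ i ∈ Finset.range (2 * r + 1), a ^ i * b ^ (2 * r - i) ≤
      (2 * r + 1) * (a ^ (2 * r) + b ^ (2 * r)) := by
  have h1 : ∑ i ∈ Finset.range (2 * r + 1), a ^ i * b ^ (2 * r - i) ≤
      ∑ i ∈ Finset.range (2 * r + 1), |a| ^ i * |b| ^ (2 * r - i) :=
    Finset.sum_le_sum fun i _ => by
      rw [← abs_pow, ← abs_pow, ← abs_mul]; exact le_abs_self _
  have h2 : ∑ i ∈ Finset.range (2 * r + 1), |a| ^ i * |b| ^ (2 * r - i) =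
      ∑ i ∈ Finset.range (2 * r + 1), |a| ^ (2 * r - i) * |b| ^ i := by
    rw [← Finset.sum_range_reflect]
    refine Finset.sum_congr rfl fun i hi => ?_
    have hi' := Finset.mem_range.1 hi
    rw [show 2 * r + 1 - 1 - i = 2 * r - i by omega, show 2 * r - (2 * r - i) = i by omega]
  have h3 : ∑ i ∈ Finset.range (2 * r + 1), (|a| ^ i * |b| ^ (2 * r - i) +
      |a| ^ (2 * r - i) * |b| ^ i) ≤
      ∑ _i ∈ Finset.range (2 * r + 1), (a ^ (2 * r) + b ^ (2 * r)) := by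
    refine Finset.sum_le_sum fun i hi => ?_
    have hi' := Finset.mem_range.1 hi
    have := pow_mul_pow_add_le |a| |b| (abs_nonneg a) (abs_nonneg b) i (2 * r - i)
    rwa [show i + (2 * r - i) = 2 * r by omega, (even_two_mul r).pow_abs,
      (even_two_mul r).pow_abs] at this
  rw [Finset.sum_add_distrib, ← h2] at h3
  simp only [Finset.sum_const, Finset.card_range, nsmul_eq_mul] at h3
  push_cast at h3
  linarith

theorem two_mul_sub_mul_pow_sub_le (a b : ℝ) (r : ℕ) :
    2 * ((a - b) * (a ^ (2 * r + 1) - b ^ (2 * r + 1))) ≤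
      (2 * r + 1) * ((a - b) ^ 2 * (a ^ (2 * r) + b ^ (2 * r))) := by
  have h := (Commute.all a b).geom_sum₂_mul (2 * r + 1)
  rw [← h]
  have h2 := mul_le_mul_of_nonneg_left (two_mul_geom_sum_le a b r) (sq_nonneg (a - b))
  simp only [Nat.add_sub_cancel]
  calc _ = (a - b) ^ 2 * (2 * ∑ i ∈ Finset.range (2 * r + 1), a ^ i * b ^ (2 * r - i)) := by ring
    _ ≤ _ := h2
    _ = _ := by ring

/-- A mean value inequality under the trace: both sides expand into traces of the form `A ^ p * B ^
q`, and `trace_pow_mul_pow` reduces the claim to the scalar case. -/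
theorem trace_sub_mul_pow_sub_le {V : Type*} [Fintype V] [DecidableEq V] {A B : Matrix V V ℝ}
    (hA : A.IsHermitian) (hB : B.IsHermitian) (r : ℕ) :
    2 * ((A - B) * (A ^ (2 * r + 1) - B ^ (2 * r + 1))).trace ≤
      (2 * r + 1) * (((A - B) * (A - B) * A ^ (2 * r)).trace +
        ((A - B) * (A - B) * B ^ (2 * r)).trace) := by
  obtain ⟨a, b, c, hc, h⟩ := trace_pow_mul_pow hA hB
  have e1 : ((A - B) * (A ^ (2 * r + 1) - B ^ (2 * r + 1))).trace =
      (A ^ (2 * r + 2) * B ^ 0).trace - (A ^ (2 * r + 1) * B ^ 1).trace -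
        (A ^ 1 * B ^ (2 * r + 1)).trace + (A ^ 0 * B ^ (2 * r + 2)).trace := by
    rw [Matrix.trace_mul_comm (A ^ (2 * r + 1)) (B ^ 1)]
    simp only [sub_mul, mul_sub, Matrix.trace_sub, pow_zero, mul_one, one_mul, pow_one]
    rw [← pow_succ' A, ← pow_succ' B]
    ring
  have e2 : ((A - B) * (A - B) * A ^ (2 * r)).trace =
      (A ^ (2 * r + 2) * B ^ 0).trace - 2 * (A ^ (2 * r + 1) * B ^ 1).trace +
        (A ^ (2 * r) * B ^ 2).trace := by
    rw [Matrix.trace_mul_comm (A ^ (2 * r)) (B ^ 2)]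
    simp only [sub_mul, mul_sub, Matrix.trace_sub, pow_zero, mul_one, pow_one]
    have t1 : (A * B * A ^ (2 * r)).trace = (A ^ (2 * r + 1) * B).trace := by
      rw [Matrix.trace_mul_comm, ← Matrix.mul_assoc, ← pow_succ]
    have t2 : (B * A * A ^ (2 * r)).trace = (A ^ (2 * r + 1) * B).trace := by
      rw [Matrix.mul_assoc, ← pow_succ', Matrix.trace_mul_comm]
    have t3 : A * A * A ^ (2 * r) = A ^ (2 * r + 2) := by
      rw [← pow_two, ← pow_add, add_comm]
    rw [t1, t2, t3, pow_two B]
    ring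
  have e3 : ((A - B) * (A - B) * B ^ (2 * r)).trace =
      (A ^ 2 * B ^ (2 * r)).trace - 2 * (A ^ 1 * B ^ (2 * r + 1)).trace +
        (A ^ 0 * B ^ (2 * r + 2)).trace := by
    simp only [sub_mul, mul_sub, Matrix.trace_sub, pow_zero, one_mul, pow_one]
    have t1 : (A * B * B ^ (2 * r)).trace = (A * B ^ (2 * r + 1)).trace := by
      rw [Matrix.mul_assoc, ← pow_succ']
    have t2 : (B * A * B ^ (2 * r)).trace = (A * B ^ (2 * r + 1)).trace := by
      rw [Matrix.trace_mul_comm, ← Matrix.mul_assoc, ← pow_succ, Matrix.trace_mul_comm]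
    have t3 : B * B * B ^ (2 * r) = B ^ (2 * r + 2) := by
      rw [← pow_two, ← pow_add, add_comm]
    rw [t1, t2, t3, pow_two A]
    ring
  rw [e1, e2, e3]
  simp only [h, Finset.mul_sum, ← Finset.sum_add_distrib, ← Finset.sum_sub_distrib]
  refine Finset.sum_le_sum fun i _ => Finset.sum_le_sum fun j _ => ?_
  have := mul_le_mul_of_nonneg_right (two_mul_sub_mul_pow_sub_le (a i) (b j) r) (hc i j)
  calc _ = 2 * ((a i - b j) * (a i ^ (2 * r + 1) - b j ^ (2 * r + 1))) * c i j := by ring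
    _ ≤ _ := this
    _ = _ := by ring

theorem trace_sq_mul_sq_le {V : Type*} [Fintype V] {A Z : Matrix V V ℝ}
    (hA : A.IsHermitian) (hZ : Z.IsHermitian)
    (hc : ∀ v : V → ℝ, A.mulVec v ⬝ᵥ A.mulVec v ≤ v ⬝ᵥ v) :
    (A * A * (Z * Z)).trace ≤ (Z * Z).trace := by
  have hA' : A.transpose = A := hA
  have hZ' : Z.transpose = Z := hZ
  have key : ∀ M : Matrix V V ℝ, (M.transpose * M).trace = ∑ j, M.col j ⬝ᵥ M.col j := by
    intro M
    simp [Matrix.trace, Matrix.mul_apply, dotProduct]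
  have h1 : (A * A * (Z * Z)).trace = ((A * Z).transpose * (A * Z)).trace := by
    rw [Matrix.transpose_mul, hA', hZ', ← Matrix.mul_assoc, Matrix.trace_mul_comm]
    simp only [Matrix.mul_assoc]
  have h2 : (Z * Z).trace = (Z.transpose * Z).trace := by rw [hZ']
  rw [h1, h2, key, key]
  refine Finset.sum_le_sum fun j _ => ?_
  have : (A * Z).col j = A.mulVec (Z.col j) := by
    ext i; simp [Matrix.mul_apply, Matrix.mulVec, dotProduct]
  rw [this]
  exact hc _

/-! ### Moments of sums of independent random matrices -/

section moments

variable {G V ι : Type*} [Fintype G] [Fintype V] [DecidableEq V] [Fintype ι] [DecidableEq ι]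

/-- Exchangeability: interchanging the `i`-th coordinate with an independent copy is an involution
on pairs. -/
theorem sum_update_swap {M : Type*} [AddCommMonoid M] (i : ι) (F : (ι → G) → G → M) :
    ∑ s : ι → G, ∑ g, F (Function.update s i g) (s i) = ∑ s : ι → G, ∑ g, F s g := by
  rw [← Fintype.sum_prod_type', ← Fintype.sum_prod_type']
  let e : (ι → G) × G → (ι → G) × G := fun x => (Function.update x.1 i x.2, x.1 i)
  have he : Function.Involutive e := by
    rintro ⟨s, g⟩
    simp [e]
  exact Fintype.sum_bijective e he.bijective _ _ fun x => rfl

/-- Let `X'` be `X` with its `i`-th summand resampled. Centering allows `Y (s i)` to be replaced by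
`Y (s i) - Y g`, and exchangeability then antisymmetrizes the expression into half the mean of the
trace of `(X - X') * (X ^ (2r+1) - X' ^ (2r+1))`. The trace inequality applies. In the resulting
squares the cross terms average to zero, and the contraction property removes the remaining squares.
-/
theorem trace_sum_moment_term {Y : G → Matrix V V ℝ} (hY : ∀ g, (Y g).IsHermitian)
    (h0 : ∑ g, Y g = 0)
    (hc : ∀ g (v : V → ℝ), (Y g).mulVec v ⬝ᵥ (Y g).mulVec v ≤ v ⬝ᵥ v) (i : ι) (r : ℕ) :
    ∑ s : ι → G, (Y (s i) * (∑ j, Y (s j)) ^ (2 * r + 1)).trace ≤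
      (2 * r + 1) * ∑ s : ι → G, ((∑ j, Y (s j)) ^ (2 * r)).trace := by
  set X : (ι → G) → Matrix V V ℝ := fun s => ∑ j, Y (s j) with hX
  have hXh : ∀ s, (X s).IsHermitian := fun s => by
    simp only [hX, Matrix.IsHermitian, Matrix.conjTranspose_sum]
    exact Finset.sum_congr rfl fun j _ => hY (s j)
  have hXu : ∀ s g, X s - X (Function.update s i g) = Y (s i) - Y g := fun s g => by
    simp only [hX, ← Finset.sum_sub_distrib]
    rw [Finset.sum_eq_single i]
    · simp
    · intro j _ hj; simp [Function.update_of_ne hj]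
    · simp
  change ∑ s : ι → G, (Y (s i) * X s ^ (2 * r + 1)).trace ≤ (2 * r + 1) * ∑ s, (X s ^ (2 * r)).trace
  rcases isEmpty_or_nonempty G with hG | hG
  · have : IsEmpty (ι → G) := ⟨fun s => hG.false (s i)⟩
    simp
  have hcard : (0 : ℝ) < Fintype.card G := by exact_mod_cast Fintype.card_pos
  have a1 : (Fintype.card G : ℝ) * ∑ s : ι → G, (Y (s i) * X s ^ (2 * r + 1)).trace =
      ∑ s : ι → G, ∑ g, ((Y (s i) - Y g) * X s ^ (2 * r + 1)).trace := by
    rw [Finset.mul_sum]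
    refine Finset.sum_congr rfl fun s _ => ?_
    rw [← Matrix.trace_sum, ← Finset.sum_mul, Finset.sum_sub_distrib, h0, sub_zero,
      Finset.sum_const, smul_mul_assoc, Matrix.trace_smul, nsmul_eq_mul, Finset.card_univ]
  have a2 : ∑ s : ι → G, ∑ g, ((Y (s i) - Y g) * X s ^ (2 * r + 1)).trace =
      ∑ s : ι → G, ∑ g, ((Y g - Y (s i)) * X (Function.update s i g) ^ (2 * r + 1)).trace := by
    rw [← sum_update_swap i]
    simp
  have a3 : ∑ s : ι → G, ∑ g, ((Y (s i) - Y g) * (Y (s i) - Y g) * X s ^ (2 * r)).trace =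
      ∑ s : ι → G, ∑ g,
        ((Y (s i) - Y g) * (Y (s i) - Y g) * X (Function.update s i g) ^ (2 * r)).trace := by
    rw [← sum_update_swap i]
    refine Finset.sum_congr rfl fun s _ => Finset.sum_congr rfl fun g _ => ?_
    rw [Function.update_self]
    congr 2
    noncomm_ring
  have a4 : ∀ s : ι → G, ∑ g, ((Y (s i) - Y g) * (Y (s i) - Y g) * X s ^ (2 * r)).trace ≤
      2 * (Fintype.card G * (X s ^ (2 * r)).trace) := by
    intro s
    have hsq : X s ^ (2 * r) = X s ^ r * X s ^ r := by rw [two_mul, pow_add]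
    have hZ : (X s ^ r).IsHermitian := (hXh s).pow r
    have hb : ∀ g, (Y g * Y g * X s ^ (2 * r)).trace ≤ (X s ^ (2 * r)).trace := fun g => by
      rw [hsq]; exact trace_sq_mul_sq_le (hY g) hZ (hc g)
    have : ∑ g, ((Y (s i) - Y g) * (Y (s i) - Y g) * X s ^ (2 * r)).trace =
        ∑ g, ((Y (s i) * Y (s i) * X s ^ (2 * r)).trace + (Y g * Y g * X s ^ (2 * r)).trace) := by
      have c1 : ∑ g, (Y (s i) * Y g * X s ^ (2 * r)).trace = 0 := by
        rw [← Matrix.trace_sum, ← Finset.sum_mul, ← Finset.mul_sum, h0]; simp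
      have c2 : ∑ g, (Y g * Y (s i) * X s ^ (2 * r)).trace = 0 := by
        rw [← Matrix.trace_sum, ← Finset.sum_mul, ← Finset.sum_mul, h0]; simp
      simp only [sub_mul, mul_sub, Matrix.trace_sub, Finset.sum_sub_distrib, Finset.sum_add_distrib,
        c1, c2]
      ring
    rw [this]
    calc _ ≤ ∑ _g : G, ((X s ^ (2 * r)).trace + (X s ^ (2 * r)).trace) :=
          Finset.sum_le_sum fun g _ => add_le_add (hb _) (hb _)
      _ = _ := by simp; ring
  have a5 : 4 * ((Fintype.card G : ℝ) * ∑ s : ι → G, (Y (s i) * X s ^ (2 * r + 1)).trace) ≤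
      2 * ((2 * r + 1) * ∑ s : ι → G, ∑ g,
        ((Y (s i) - Y g) * (Y (s i) - Y g) * X s ^ (2 * r)).trace) := by
    calc _ = 2 * (∑ s : ι → G, ∑ g, ((Y (s i) - Y g) * X s ^ (2 * r + 1)).trace +
          ∑ s : ι → G, ∑ g,
            ((Y g - Y (s i)) * X (Function.update s i g) ^ (2 * r + 1)).trace) := by
          rw [← a2, ← a1]; ring
      _ = ∑ s : ι → G, ∑ g, 2 * ((X s - X (Function.update s i g)) *
            (X s ^ (2 * r + 1) - X (Function.update s i g) ^ (2 * r + 1))).trace := by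
          simp only [← Finset.sum_add_distrib, Finset.mul_sum, hXu]
          refine Finset.sum_congr rfl fun s _ => Finset.sum_congr rfl fun g _ => ?_
          simp only [sub_mul, mul_sub, Matrix.trace_sub]
          ring
      _ ≤ ∑ s : ι → G, ∑ g, (2 * r + 1) *
            (((Y (s i) - Y g) * (Y (s i) - Y g) * X s ^ (2 * r)).trace +
            ((Y (s i) - Y g) * (Y (s i) - Y g) * X (Function.update s i g) ^ (2 * r)).trace) := by
          refine Finset.sum_le_sum fun s _ => Finset.sum_le_sum fun g _ => ?_
          have := trace_sub_mul_pow_sub_le (hXh s) (hXh (Function.update s i g)) r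
          rwa [hXu s g] at this ⊢
      _ = _ := by
          simp only [← Finset.mul_sum, Finset.sum_add_distrib]
          rw [← a3]; ring
  have a6 : ∑ s : ι → G, ∑ g, ((Y (s i) - Y g) * (Y (s i) - Y g) * X s ^ (2 * r)).trace ≤
      2 * (Fintype.card G * ∑ s, (X s ^ (2 * r)).trace) := by
    rw [Finset.mul_sum, Finset.mul_sum]
    exact Finset.sum_le_sum fun s _ => a4 s
  have a7 : (2 * (r : ℝ) + 1) * ∑ s : ι → G, ∑ g,
      ((Y (s i) - Y g) * (Y (s i) - Y g) * X s ^ (2 * r)).trace ≤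
      (2 * r + 1) * (2 * (Fintype.card G * ∑ s, (X s ^ (2 * r)).trace)) :=
    mul_le_mul_of_nonneg_left a6 (by positivity)
  refine le_of_mul_le_mul_left ?_ hcard
  linarith

theorem trace_even_pow_nonneg {A : Matrix V V ℝ} (hA : A.IsHermitian) (r : ℕ) :
    0 ≤ (A ^ (2 * r)).trace := by
  obtain ⟨a, b, c, hc, h⟩ := trace_pow_mul_pow hA hA
  have := h (2 * r) 0
  rw [pow_zero, mul_one] at this
  rw [this]
  refine Finset.sum_nonneg fun i _ => Finset.sum_nonneg fun j _ => ?_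
  have := (even_two_mul r).pow_nonneg (a i)
  have := hc i j
  positivity

theorem sum_trace_pow_le {Y : G → Matrix V V ℝ} (hY : ∀ g, (Y g).IsHermitian)
    (h0 : ∑ g, Y g = 0)
    (hc : ∀ g (v : V → ℝ), (Y g).mulVec v ⬝ᵥ (Y g).mulVec v ≤ v ⬝ᵥ v) (p r : ℕ) (hr : r ≤ p) :
    ∑ s : ι → G, ((∑ j, Y (s j)) ^ (2 * r)).trace ≤
      (2 * p * Fintype.card ι : ℝ) ^ r *
        ((Fintype.card G : ℝ) ^ Fintype.card ι * Fintype.card V) := by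
  induction r with
  | zero => simp
  | succ r ih =>
    have hnn : 0 ≤ ∑ s : ι → G, ((∑ j, Y (s j)) ^ (2 * r)).trace :=
      Finset.sum_nonneg fun s _ => trace_even_pow_nonneg (by
        simp only [Matrix.IsHermitian, Matrix.conjTranspose_sum]
        exact Finset.sum_congr rfl fun j _ => hY (s j)) r
    have hrp : (r : ℝ) + 1 ≤ p := by exact_mod_cast hr
    calc ∑ s : ι → G, ((∑ j, Y (s j)) ^ (2 * (r + 1))).trace
        = ∑ i : ι, ∑ s : ι → G, (Y (s i) * (∑ j, Y (s j)) ^ (2 * r + 1)).trace := by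
          rw [Finset.sum_comm]
          refine Finset.sum_congr rfl fun s _ => ?_
          rw [← Matrix.trace_sum, ← Finset.sum_mul, ← pow_succ']
          rfl
      _ ≤ ∑ _i : ι, (2 * r + 1) * ∑ s : ι → G, ((∑ j, Y (s j)) ^ (2 * r)).trace :=
          Finset.sum_le_sum fun i _ => trace_sum_moment_term hY h0 hc i r
      _ = ((2 * r + 1) * Fintype.card ι) * ∑ s : ι → G, ((∑ j, Y (s j)) ^ (2 * r)).trace := by
          simp; ring
      _ ≤ (2 * p * Fintype.card ι) * ∑ s : ι → G, ((∑ j, Y (s j)) ^ (2 * r)).trace := by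
          gcongr; linarith
      _ ≤ (2 * p * Fintype.card ι) * ((2 * p * Fintype.card ι : ℝ) ^ r *
            ((Fintype.card G : ℝ) ^ Fintype.card ι * Fintype.card V)) := by
          gcongr; exact ih (by omega)
      _ = _ := by ring

end moments

/-! ### The second eigenvalue of a transitive random walk -/

theorem secondEigenvalue_le_of_trace {V : Type*} [Fintype V] [DecidableEq V] {A : Matrix V V ℝ}
    (hA : A.IsHermitian) {v : V → ℝ} (hv : v ≠ 0) (hAv : A.mulVec v = v) {p : ℕ} (hp : p ≠ 0)
    {t : ℝ} (ht : 0 ≤ t) (h : (A ^ (2 * p)).trace - 1 ≤ t ^ (2 * p)) :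
    secondEigenvalue hA ≤ t := by
  unfold secondEigenvalue
  split_ifs with hcard
  swap
  -- Fewer than two vertices: the value is 0 by convention.
  · exact ht
  have htr : (A ^ (2 * p)).trace = ∑ i, hA.eigenvalues₀ i ^ (2 * p) := by
    rw [hA.exists_pow_eq, Matrix.trace_mul_comm, ← Matrix.mul_assoc]
    have hU : (hA.eigenvectorUnitary : Matrix V V ℝ).transpose *
        (hA.eigenvectorUnitary : Matrix V V ℝ) = 1 :=
      Unitary.coe_star_mul_self hA.eigenvectorUnitary
    rw [hU, one_mul, Matrix.trace_diagonal]
    unfold Matrix.IsHermitian.eigenvalues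
    exact Equiv.sum_comp (Fintype.equivOfCardEq (Fintype.card_fin _)).symm
      (fun i => hA.eigenvalues₀ i ^ (2 * p))
  have hspec : (1 : ℝ) ∈ spectrum ℝ A := by
    rw [← Matrix.spectrum_toLin']
    refine Module.End.HasEigenvalue.mem_spectrum
      (Module.End.hasEigenvalue_of_hasEigenvector (x := v) ?_)
    exact ⟨Module.End.mem_eigenspace_iff.2 (by simp [hAv]), hv⟩
  rw [hA.spectrum_real_eq_range_eigenvalues] at hspec
  obtain ⟨i, hi⟩ := hspec
  -- The top eigenvalue need not be identified with 1: being at least 1, its even power already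
  -- accounts for the 1 subtracted from the trace.
  have h1 : 1 ≤ hA.eigenvalues₀ ⟨0, by omega⟩ := by
    rw [← hi]
    exact hA.eigenvalues₀_antitone (Fin.mk_le_of_le_val (Nat.zero_le _))
  have hj : ∀ j : Fin (Fintype.card V), j ≠ ⟨0, by omega⟩ → |hA.eigenvalues₀ j| ≤ t := by
    intro j hj
    have h2 : hA.eigenvalues₀ ⟨0, by omega⟩ ^ (2 * p) + hA.eigenvalues₀ j ^ (2 * p) ≤
        (A ^ (2 * p)).trace := by
      rw [htr, ← Finset.sum_pair (f := fun i => hA.eigenvalues₀ i ^ (2 * p)) hj.symm]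
      exact Finset.sum_le_sum_of_subset_of_nonneg (Finset.subset_univ _)
        fun i _ _ => (even_two_mul p).pow_nonneg _
    have h3 : 1 ≤ hA.eigenvalues₀ ⟨0, by omega⟩ ^ (2 * p) := one_le_pow₀ h1
    refine le_of_pow_le_pow_left₀ (n := 2 * p) (by omega) ht ?_
    rw [(even_two_mul p).pow_abs]
    linarith
  refine max_le ((le_abs_self _).trans (hj _ ?_)) ((neg_le_abs _).trans (hj _ ?_))
  · simp
  · simp only [ne_eq, Fin.mk.injEq]; omega

/-- The matrix of the averaging operator. -/
noncomputable def averageMatrix (V : Type*) [Fintype V] : Matrix V V ℝ :=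
  fun _ _ => (Fintype.card V : ℝ)⁻¹

theorem averageMatrix_mulVec [Fintype V] (f : V → ℝ) (v : V) :
    (averageMatrix V).mulVec f v = (Fintype.card V : ℝ)⁻¹ * ∑ w, f w := by
  simp [averageMatrix, Matrix.mulVec, dotProduct, Finset.mul_sum]

theorem averageMatrix_mul_self [Fintype V] : averageMatrix V * averageMatrix V = averageMatrix V := by
  ext v w
  have : Nonempty V := ⟨v⟩
  simp [averageMatrix, Matrix.mul_apply]

theorem trace_averageMatrix [Fintype V] [Nonempty V] : (averageMatrix V).trace = 1 := by
  simp [averageMatrix, Matrix.trace]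

section action

variable {G V : Type*} [Group G] [MulAction G V] [DecidableEq V]

/-- The permutation matrix of the action of `g`. -/
def actionMatrix (V : Type*) [MulAction G V] [DecidableEq V] (g : G) : Matrix V V ℝ :=
  fun v w => if g • v = w then 1 else 0

theorem actionMatrix_transpose (g : G) :
    (actionMatrix V g).transpose = actionMatrix V g⁻¹ := by
  ext v w
  simp only [actionMatrix, Matrix.transpose_apply, inv_smul_eq_iff, @eq_comm _ v]

theorem actionMatrix_mulVec [Fintype V] (g : G) (f : V → ℝ) (v : V) :
    (actionMatrix V g).mulVec f v = f (g • v) := by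
  simp [actionMatrix, Matrix.mulVec, dotProduct]

theorem actionMatrix_mul_averageMatrix [Fintype V] (g : G) :
    actionMatrix V g * averageMatrix V = averageMatrix V := by
  ext v w
  simp [averageMatrix, actionMatrix, Matrix.mul_apply]

/-- By transitivity, the number of `g` taking `v` to `w` does not depend on `w`, and each row sums
to `|G|`. -/
theorem sum_actionMatrix [Fintype V] [Fintype G] [MulAction.IsPretransitive G V] :
    ∑ g : G, actionMatrix V g = (Fintype.card G : ℝ) • averageMatrix V := by
  ext v w
  have : Nonempty V := ⟨v⟩
  have hV : (Fintype.card V : ℝ) ≠ 0 := by exact_mod_cast Fintype.card_ne_zero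
  have hconst : ∀ w', ∑ g : G, actionMatrix V g v w' = ∑ g : G, actionMatrix V g v w := by
    intro w'
    obtain ⟨h, rfl⟩ := MulAction.exists_smul_eq G w w'
    refine (Fintype.sum_bijective (fun g => h * g) (Group.mulLeft_bijective h) _ _ fun g => ?_).symm
    simp [actionMatrix, mul_smul]
  have hsum : ∑ w', ∑ g : G, actionMatrix V g v w' = Fintype.card G := by
    rw [Finset.sum_comm]
    simp [actionMatrix]
  simp only [hconst, Finset.sum_const, nsmul_eq_mul, Finset.card_univ] at hsum
  rw [Matrix.sum_apply, Matrix.smul_apply, averageMatrix, smul_eq_mul, ← hsum]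
  field_simp

/-- The symmetrized permutation matrix of `g`, with the constants projected out. -/
noncomputable def centeredActionMatrix (V : Type*) [MulAction G V] [DecidableEq V] [Fintype V]
    (g : G) : Matrix V V ℝ :=
  (2 : ℝ)⁻¹ • (actionMatrix V g + actionMatrix V g⁻¹) - averageMatrix V

theorem centeredActionMatrix_isHermitian [Fintype V] (g : G) :
    (centeredActionMatrix V g).IsHermitian := by
  change (centeredActionMatrix V g).transpose = _
  rw [centeredActionMatrix, Matrix.transpose_sub, Matrix.transpose_smul, Matrix.transpose_add,
    actionMatrix_transpose, actionMatrix_transpose, inv_inv, add_comm (actionMatrix V g)]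
  rfl

theorem sum_centeredActionMatrix [Fintype V] [Fintype G] [MulAction.IsPretransitive G V] :
    ∑ g : G, centeredActionMatrix V g = 0 := by
  have h : ∑ g : G, actionMatrix V g⁻¹ = ∑ g : G, actionMatrix V g :=
    Equiv.sum_comp (Equiv.inv G) _
  simp only [centeredActionMatrix, Finset.sum_sub_distrib, ← Finset.smul_sum,
    Finset.sum_add_distrib, h, sum_actionMatrix, Finset.sum_const, Finset.card_univ,
    ← Nat.cast_smul_eq_nsmul ℝ]
  module

/-- The image of `f` is the mean of two translates of `f - m`, where `m` is the average of `f`.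
Convexity of the square bounds its norm by that of `f - m`, and a variance is at most the second
moment. -/
theorem centeredActionMatrix_mulVec_le [Fintype V] (g : G) (f : V → ℝ) :
    (centeredActionMatrix V g).mulVec f ⬝ᵥ (centeredActionMatrix V g).mulVec f ≤ f ⬝ᵥ f := by
  rcases isEmpty_or_nonempty V with hV | hV
  · simp [dotProduct]
  have hV : (Fintype.card V : ℝ) ≠ 0 := by exact_mod_cast Fintype.card_ne_zero
  set m : ℝ := (Fintype.card V : ℝ)⁻¹ * ∑ w, f w with hm
  have happ : ∀ v, (centeredActionMatrix V g).mulVec f v =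
      2⁻¹ * ((f (g • v) - m) + (f (g⁻¹ • v) - m)) := by
    intro v
    simp only [centeredActionMatrix, Matrix.sub_mulVec, Matrix.smul_mulVec, Matrix.add_mulVec,
      Pi.sub_apply, Pi.smul_apply, Pi.add_apply, actionMatrix_mulVec, averageMatrix_mulVec,
      smul_eq_mul, ← hm]
    ring
  have hg : ∀ h : G, ∑ v, (f (h • v) - m) ^ 2 = ∑ v, (f v - m) ^ 2 := fun h =>
    Equiv.sum_comp (MulAction.toPerm h) (fun v => (f v - m) ^ 2)
  have hvar : ∑ v, (f v - m) ^ 2 ≤ ∑ v, f v * f v := by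
    have hs : ∑ w, f w = Fintype.card V * m := by rw [hm]; field_simp
    have : ∑ v, (f v - m) ^ 2 = ∑ v, f v * f v - Fintype.card V * m ^ 2 := by
      calc _ = ∑ v, (f v * f v - 2 * m * f v + m ^ 2) :=
            Finset.sum_congr rfl fun v _ => by ring
        _ = _ := by
            rw [Finset.sum_add_distrib, Finset.sum_sub_distrib, ← Finset.mul_sum, hs]
            simp
            ring
    rw [this]
    have : 0 ≤ (Fintype.card V : ℝ) * m ^ 2 := by positivity
    linarith
  simp only [dotProduct, happ]
  calc _ ≤ ∑ v, (2⁻¹ * (f (g • v) - m) ^ 2 + 2⁻¹ * (f (g⁻¹ • v) - m) ^ 2) :=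
        Finset.sum_le_sum fun v _ => by
          nlinarith [sq_nonneg ((f (g • v) - m) - (f (g⁻¹ • v) - m))]
    _ = ∑ v, (f v - m) ^ 2 := by
        rw [Finset.sum_add_distrib, ← Finset.mul_sum, ← Finset.mul_sum, hg, hg]; ring
    _ ≤ _ := hvar

end action

theorem sub_pow_of_absorbing {R : Type*} [Ring R] {T Q : R} (h1 : T * Q = Q) (h2 : Q * T = Q)
    (h3 : Q * Q = Q) (m : ℕ) : (T - Q) ^ (m + 1) = T ^ (m + 1) - Q := by
  have hT : ∀ m : ℕ, T ^ m * Q = Q := fun m => by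
    induction m with
    | zero => simp
    | succ m ih => rw [pow_succ, mul_assoc, h1, ih]
  induction m with
  | zero => simp
  | succ m ih =>
    rw [pow_succ, ih, sub_mul, mul_sub, mul_sub, hT, h2, h3, ← pow_succ]
    abel

/-! ### Random symmetric multisets are expanding -/

section expander

variable {G ι : Type*} [Group G] [Fintype ι]

/-- The symmetric multiset formed by the entries of a tuple and their inverses. -/
def symmetrization (s : ι → G) : Multiset G :=
  Finset.univ.val.map s + Finset.univ.val.map (fun i => (s i)⁻¹)

theorem isSymmetricMultiset_symmetrization (s : ι → G) :
    IsSymmetricMultiset (symmetrization s) := by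
  simp [IsSymmetricMultiset, symmetrization, Multiset.map_map, add_comm]

theorem card_symmetrization (s : ι → G) :
    (symmetrization s).card = 2 * Fintype.card ι := by
  simp [symmetrization, two_mul]

open Classical in
theorem schreierAdjacency_symmetrization (H : Subgroup G) (s : ι → G) :
    schreierAdjacency H (symmetrization s) =
      ∑ i, (actionMatrix (G ⧸ H) (s i) + actionMatrix (G ⧸ H) (s i)⁻¹) := by
  ext v w
  simp only [schreierAdjacency, symmetrization, Multiset.countP_add, Multiset.countP_map,
    Matrix.sum_apply, Matrix.add_apply, actionMatrix, Finset.sum_add_distrib, Finset.sum_boole]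
  push_cast
  rfl

open Classical in
theorem schreierTransition_sub_averageMatrix [Fintype G] [Nonempty ι] (H : Subgroup G)
    (s : ι → G) :
    schreierTransition H (symmetrization s) - averageMatrix (G ⧸ H) =
      (Fintype.card ι : ℝ)⁻¹ • ∑ i, centeredActionMatrix (G ⧸ H) (s i) := by
  have hι : (Fintype.card ι : ℝ) ≠ 0 := by exact_mod_cast Fintype.card_ne_zero
  rw [schreierTransition, schreierAdjacency_symmetrization, card_symmetrization]
  simp only [centeredActionMatrix, Finset.sum_sub_distrib, ← Finset.smul_sum, Finset.sum_const,
    smul_sub, smul_smul, Finset.card_univ]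
  congr 2
  · push_cast; rw [mul_inv, mul_comm]
  · rw [← Nat.cast_smul_eq_nsmul ℝ, smul_smul, inv_mul_cancel₀ hι, one_smul]

open Classical in
theorem schreierTransition_mul_averageMatrix [Fintype G] [Nonempty ι] (H : Subgroup G)
    (s : ι → G) :
    schreierTransition H (symmetrization s) * averageMatrix (G ⧸ H) = averageMatrix (G ⧸ H) := by
  have hι : (Fintype.card ι : ℝ) ≠ 0 := by exact_mod_cast Fintype.card_ne_zero
  rw [schreierTransition, schreierAdjacency_symmetrization, card_symmetrization, smul_mul_assoc,
    Finset.sum_mul]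
  simp only [add_mul, actionMatrix_mul_averageMatrix, Finset.sum_const, Finset.card_univ,
    ← Nat.cast_smul_eq_nsmul ℝ]
  push_cast
  rw [← two_smul ℝ (averageMatrix (G ⧸ H)), smul_smul, smul_smul, mul_assoc, mul_comm (Fintype.card ι : ℝ),
    inv_mul_cancel₀ (by positivity), one_smul]

open Classical in
theorem averageMatrix_mul_schreierTransition [Fintype G] [Nonempty ι] (H : Subgroup G)
    (s : ι → G) :
    averageMatrix (G ⧸ H) * schreierTransition H (symmetrization s) = averageMatrix (G ⧸ H) := by
  have h := congrArg Matrix.transpose (schreierTransition_mul_averageMatrix H s)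
  have hT : (schreierTransition H (symmetrization s)).transpose = _ :=
    schreierTransition_isHermitian H (isSymmetricMultiset_symmetrization s)
  rw [Matrix.transpose_mul, hT] at h
  exact h

open Classical in
theorem schreierLambda_symmetrization_le [Fintype G] [Nonempty ι] (H : Subgroup G) (s : ι → G)
    {p : ℕ} (hp : p ≠ 0) {t : ℝ} (ht : 0 ≤ t)
    (h : ((∑ i, centeredActionMatrix (G ⧸ H) (s i)) ^ (2 * p)).trace ≤
      (Fintype.card ι * t) ^ (2 * p)) :
    schreierLambda H (isSymmetricMultiset_symmetrization s) ≤ t := by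
  have hι : (0 : ℝ) < Fintype.card ι := by exact_mod_cast Fintype.card_pos
  have h1 := schreierTransition_mul_averageMatrix H s
  have h2 := averageMatrix_mul_schreierTransition H s
  -- The absorption identity for powers of `T - Q` needs a positive exponent.
  obtain ⟨m, hm⟩ : ∃ m, 2 * p = m + 1 := ⟨2 * p - 1, by omega⟩
  have h3 : (schreierTransition H (symmetrization s) ^ (2 * p)).trace - 1 =
      ((schreierTransition H (symmetrization s) - averageMatrix (G ⧸ H)) ^ (2 * p)).trace := by
    rw [hm, sub_pow_of_absorbing h1 h2 averageMatrix_mul_self, Matrix.trace_sub,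
      trace_averageMatrix]
  unfold schreierLambda
  refine secondEigenvalue_le_of_trace (v := fun _ => 1) _ ?_ ?_ hp ht ?_
  · intro h0
    exact one_ne_zero (congrFun h0 (QuotientGroup.mk 1))
  · have h4 : (averageMatrix (G ⧸ H)).mulVec (fun _ => 1) = fun _ => 1 := by
      ext v; simp [averageMatrix_mulVec]
    rw [← h4, Matrix.mulVec_mulVec, h1]
  · rw [h3, schreierTransition_sub_averageMatrix, smul_pow, Matrix.trace_smul, smul_eq_mul, inv_pow,
      inv_mul_le_iff₀ (by positivity), ← mul_pow]
    exact h

open Classical in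
-- By Markov's inequality the non-expanding fraction is at most `(2pk)^p |G/H| / (kt)^(2p)`. The
-- condition `4p ≤ k t²` reduces this to `|G/H| / 2^p`, which is at most one half.
theorem card_le_two_mul_card_expanding [Fintype G] [Nonempty ι] (H : Subgroup G) {p : ℕ} {t : ℝ}
    (ht : 0 < t) (hp : p ≠ 0) (hpt : 4 * p ≤ Fintype.card ι * t ^ 2)
    (hV : 2 * (Fintype.card (G ⧸ H) : ℝ) ≤ 2 ^ p) :
    Fintype.card (ι → G) ≤ 2 * (Finset.univ.filter fun s : ι → G =>
      schreierLambda H (isSymmetricMultiset_symmetrization s) ≤ t).card := by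
  have hι : (0 : ℝ) < Fintype.card ι := by exact_mod_cast Fintype.card_pos
  set k : ℝ := (Fintype.card ι : ℝ) with hk
  set X : (ι → G) → ℝ := fun s =>
    ((∑ i, centeredActionMatrix (G ⧸ H) (s i)) ^ (2 * p)).trace with hX
  set B := Finset.univ.filter fun s : ι → G =>
    ¬ schreierLambda H (isSymmetricMultiset_symmetrization s) ≤ t with hB
  have hXnn : ∀ s, 0 ≤ X s := fun s => trace_even_pow_nonneg (by
    simp only [Matrix.IsHermitian, Matrix.conjTranspose_sum]
    exact Finset.sum_congr rfl fun j _ => centeredActionMatrix_isHermitian _) p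
  have hsum : ∑ s, X s ≤ (2 * p * k) ^ p * ((Fintype.card G : ℝ) ^ Fintype.card ι *
      Fintype.card (G ⧸ H)) :=
    sum_trace_pow_le (fun g => centeredActionMatrix_isHermitian g) sum_centeredActionMatrix
      (fun g v => centeredActionMatrix_mulVec_le g v) p p le_rfl
  have hmarkov : (B.card : ℝ) * (k * t) ^ (2 * p) ≤ ∑ s, X s := by
    calc (B.card : ℝ) * (k * t) ^ (2 * p) = ∑ _s ∈ B, (k * t) ^ (2 * p) := by simp
      _ ≤ ∑ s ∈ B, X s := by
          refine Finset.sum_le_sum fun s hs => ?_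
          by_contra hlt
          exact (Finset.mem_filter.1 hs).2
            (schreierLambda_symmetrization_le H s hp ht.le (not_le.1 hlt).le)
      _ ≤ _ := Finset.sum_le_sum_of_subset_of_nonneg (Finset.subset_univ _) fun s _ _ => hXnn s
  have hpow : 2 ^ p * (2 * p * k) ^ p ≤ (k * t) ^ (2 * p) := by
    rw [← mul_pow, pow_mul]
    refine pow_le_pow_left₀ (by positivity) ?_ p
    calc 2 * (2 * p * k) = k * (4 * p) := by ring
      _ ≤ k * (k * t ^ 2) := by gcongr
      _ = _ := by ring
  have hkey : 2 * (B.card : ℝ) ≤ Fintype.card (ι → G) := by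
    have hG : ((Fintype.card G : ℝ) ^ Fintype.card ι) = Fintype.card (ι → G) := by simp
    rw [hG] at hsum
    have hpos : 0 < (k * t) ^ (2 * p) := by positivity
    refine le_of_mul_le_mul_right ?_ hpos
    calc 2 * (B.card : ℝ) * (k * t) ^ (2 * p) = 2 * (B.card * (k * t) ^ (2 * p)) := by ring
      _ ≤ 2 * ((2 * p * k) ^ p * (Fintype.card (ι → G) * Fintype.card (G ⧸ H))) := by
          exact mul_le_mul_of_nonneg_left (hmarkov.trans hsum) zero_le_two
      _ = Fintype.card (ι → G) * ((2 * (Fintype.card (G ⧸ H) : ℝ)) * (2 * p * k) ^ p) := by ring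
      _ ≤ Fintype.card (ι → G) * (2 ^ p * (2 * p * k) ^ p) := by gcongr
      _ ≤ _ := by gcongr
  have hadd : (Finset.univ.filter fun s : ι → G =>
      schreierLambda H (isSymmetricMultiset_symmetrization s) ≤ t).card + B.card =
      Fintype.card (ι → G) := by
    have := Finset.card_filter_add_card_filter_not (s := (Finset.univ : Finset (ι → G)))
      (fun s => schreierLambda H (isSymmetricMultiset_symmetrization s) ≤ t)
    rw [Finset.card_univ] at this
    convert this
  have hkey' : 2 * B.card ≤ Fintype.card (ι → G) := by exact_mod_cast hkey
  omega

end expander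

/-! ### Counting strings by type -/

theorem permuteString_one {X : Type*} {n : ℕ} (x : Fin n → X) : permuteString 1 x = x := rfl

theorem permuteString_mul {X : Type*} {n : ℕ} (s t : Equiv.Perm (Fin n)) (x : Fin n → X) :
    permuteString (s * t) x = permuteString s (permuteString t x) := by
  funext i
  simp [permuteString]

theorem condTypeClass_eq_of_mem {X : Type*} [DecidableEq X] {n : ℕ} {V : X → X → ℝ} {x y : Fin n → X}
    (hy : y ∈ condTypeClass V x) :
    condTypeClass V x = {z | jointType x z = jointType x y} := by
  ext z
  constructor
  · intro hz
    funext a b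
    rw [← hz a b, ← hy a b]
  · intro hz a b
    rw [hy a b, ← hz]

theorem stringType_permuteString {X : Type*} [DecidableEq X] {n : ℕ}
    (s : Equiv.Perm (Fin n)) (x : Fin n → X) :
    stringType (permuteString s x) = stringType x := by
  funext a
  unfold stringType
  congr 2
  refine Finset.card_bijective (s⁻¹ : Equiv.Perm (Fin n)) (Equiv.bijective _) fun i => ?_
  rw [Finset.mem_filter_univ, Finset.mem_filter_univ]
  rfl

open Classical in
theorem card_quotient_isotropy_le {X : Type*} [Fintype X] {n : ℕ}
    (x : Fin n → X) :
    Fintype.card (Equiv.Perm (Fin n) ⧸ isotropy x) ≤ Fintype.card X ^ n := by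
  have h := Fintype.card_le_of_injective
    (fun v : Equiv.Perm (Fin n) ⧸ isotropy x => permuteString v.out x) fun v w hvw => by
      rw [← v.out_eq', ← w.out_eq']
      refine QuotientGroup.eq.2 ?_
      change permuteString _ x = x
      replace hvw : permuteString v.out x = permuteString w.out x := hvw
      rw [permuteString_mul, ← hvw, ← permuteString_mul, inv_mul_cancel, permuteString_one]
  simpa using h

section types

variable {X : Type*} [Fintype X] [DecidableEq X] {n : ℕ}

/-- The permutations taking `x` to `y` are either none or a coset of the stabilizer of `x`, whose
order is the product of the factorials. -/
theorem card_permuteString_eq_le (x y : Fin n → X) :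
    (Finset.univ.filter fun s : Equiv.Perm (Fin n) => permuteString s x = y).card ≤
      ∏ a, (Finset.univ.filter fun i => x i = a).card.factorial := by
  have h : (Finset.univ.filter fun s : Equiv.Perm (Fin n) => permuteString s x = x).card =
      ∏ a, (Finset.univ.filter fun i => x i = a).card.factorial := by
    have := DomMulAct.stabilizer_card x
    simp only [Fintype.card_subtype] at this
    rw [← this]
    refine Finset.card_bijective (fun s => s⁻¹) (Equiv.bijective (Equiv.inv _)) fun s => ?_
    simp only [Finset.mem_filter, Finset.mem_univ, true_and]
    rfl
  rw [← h]
  rcases (Finset.univ.filter fun s : Equiv.Perm (Fin n) =>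
    permuteString s x = y).eq_empty_or_nonempty with h0 | ⟨t, ht⟩
  · simp [h0]
  · refine Finset.card_le_card_of_injOn (fun s => t⁻¹ * s) (fun s hs => ?_)
      (fun s _ s' _ hss => mul_left_cancel hss)
    simp only [Finset.coe_filter, Finset.mem_univ, true_and, Set.mem_ofPred_eq,
      Finset.mem_filter] at hs ht ⊢
    rw [permuteString_mul, hs, ← ht, ← permuteString_mul, inv_mul_cancel, permuteString_one]

theorem factorial_mul_pow_le (c k : ℕ) :
    c.factorial * c ^ k ≤ k.factorial * c ^ c := by
  rcases le_total c k with h | h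
  · obtain ⟨d, rfl⟩ := Nat.exists_eq_add_of_le h
    calc c.factorial * c ^ (c + d) = c.factorial * c ^ d * c ^ c := by ring
      _ ≤ _ := by
          gcongr
          have := Nat.factorial_mul_pow_sub_le_factorial h
          simpa using this
  · obtain ⟨d, rfl⟩ := Nat.exists_eq_add_of_le h
    have h1 := Nat.factorial_mul_descFactorial (n := k + d) (k := d) (by omega)
    rw [Nat.add_sub_cancel] at h1
    rw [← h1, pow_add]
    calc k.factorial * (k + d).descFactorial d * (k + d) ^ k
        ≤ k.factorial * (k + d) ^ d * (k + d) ^ k := by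
          gcongr; exact Nat.descFactorial_le_pow _ _
      _ = _ := by ring

/-- In the multinomial expansion of `(∑ a, c a) ^ n`, with `n = ∑ a, c a`, the term with exponents
`c` is the largest, by `factorial_mul_pow_le`, and there are at most `(n + 1) ^ |X|` terms. This is
the standard lower bound on the size of a type class. -/
theorem prod_factorial_mul_pow_le (c : X → ℕ) :
    (∏ a, (c a).factorial) * (∑ a, c a) ^ (∑ a, c a) ≤
      (∑ a, c a + 1) ^ Fintype.card X * ((∑ a, c a).factorial * ∏ a, c a ^ c a) := by
  set n := ∑ a, c a with hn
  have hsum := Finset.sum_pow_eq_sum_piAntidiag Finset.univ c n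
  rw [← hn] at hsum
  have hcard : (Finset.univ.piAntidiag n : Finset (X → ℕ)).card ≤ (n + 1) ^ Fintype.card X := by
    calc _ ≤ (Fintype.piFinset fun _ : X => Finset.range (n + 1)).card := by
          refine Finset.card_le_card fun k hk => ?_
          rw [Finset.mem_piAntidiag] at hk
          rw [Fintype.mem_piFinset]
          intro a
          rw [Finset.mem_range, Nat.lt_succ_iff, ← hk.1]
          exact Finset.single_le_sum (f := k) (fun _ _ => Nat.zero_le _) (Finset.mem_univ a)
      _ = _ := by simp
  rw [hsum, Finset.mul_sum]
  refine (Finset.sum_le_card_nsmul _ _ (n.factorial * ∏ a, c a ^ c a) fun k hk => ?_).trans ?_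
  · have hk' := (Finset.mem_piAntidiag.1 hk).1
    have hspec := Nat.multinomial_spec Finset.univ k
    rw [hk'] at hspec
    calc (∏ a, (c a).factorial) * ((Nat.multinomial Finset.univ k : ℕ) * ∏ a, c a ^ k a)
        = Nat.multinomial Finset.univ k * ∏ a, ((c a).factorial * c a ^ k a) := by
          rw [Finset.prod_mul_distrib]; ring
      _ ≤ Nat.multinomial Finset.univ k * ∏ a, ((k a).factorial * c a ^ c a) := by
          exact Nat.mul_le_mul_left _ (Finset.prod_le_prod' fun a _ => factorial_mul_pow_le _ _)
      _ = _ := by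
          rw [Finset.prod_mul_distrib, ← hspec]; ring
  · rw [smul_eq_mul]
    gcongr

theorem sum_card_fiber (x : Fin n → X) :
    ∑ a, (Finset.univ.filter fun i => x i = a).card = n := by
  rw [← Finset.card_eq_sum_card_fiberwise (fun i _ => Finset.mem_coe.2 (Finset.mem_univ (x i)))]
  simp

theorem exp_neg_mul_shannonEntropy (hn : n ≠ 0) (x : Fin n → X) :
    Real.exp (-(n * shannonEntropy (stringType x))) * (n : ℝ) ^ n =
      ∏ a, ((Finset.univ.filter fun i => x i = a).card : ℝ) ^
        (Finset.univ.filter fun i => x i = a).card := by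
  have hn' : (n : ℝ) ≠ 0 := by exact_mod_cast hn
  set c : X → ℕ := fun a => (Finset.univ.filter fun i => x i = a).card with hc
  have h1 : ∀ a, Real.exp (n * (stringType x a * Real.log (stringType x a))) * (n : ℝ) ^ c a =
      (c a : ℝ) ^ c a := by
    intro a
    have : stringType x a = (c a : ℝ) / n := rfl
    rw [this]
    rcases Nat.eq_zero_or_pos (c a) with h0 | h0
    · simp [h0]
    · have h0' : (0 : ℝ) < c a := by exact_mod_cast h0
      have h2 : (0 : ℝ) < (c a : ℝ) / n := by positivity
      rw [← mul_assoc, mul_div_cancel₀ _ hn', Real.exp_nat_mul, Real.exp_log h2, div_pow]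
      field_simp
  have h2 : (n : ℝ) ^ n = ∏ a, (n : ℝ) ^ c a := by
    rw [Finset.prod_pow_eq_pow_sum, sum_card_fiber]
  rw [h2, shannonEntropy, mul_neg, neg_neg, Finset.mul_sum, Real.exp_sum, ← Finset.prod_mul_distrib]
  exact Finset.prod_congr rfl fun a _ => h1 a

theorem prod_factorial_le (hn : n ≠ 0) (x : Fin n → X) :
    ((∏ a, (Finset.univ.filter fun i => x i = a).card.factorial : ℕ) : ℝ) ≤
      n.factorial * ((n + 1 : ℝ) ^ Fintype.card X *
        Real.exp (-(n * shannonEntropy (stringType x)))) := by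
  have h := prod_factorial_mul_pow_le fun a => (Finset.univ.filter fun i => x i = a).card
  simp only [sum_card_fiber] at h
  have hn' : (0 : ℝ) < (n : ℝ) ^ n := by positivity
  refine le_of_mul_le_mul_right ?_ hn'
  have h' : ((∏ a, (Finset.univ.filter fun i => x i = a).card.factorial : ℕ) : ℝ) * (n : ℝ) ^ n ≤
      (n + 1 : ℝ) ^ Fintype.card X * (n.factorial *
        ∏ a, ((Finset.univ.filter fun i => x i = a).card : ℝ) ^
          (Finset.univ.filter fun i => x i = a).card) := by
    exact_mod_cast h
  refine h'.trans_eq ?_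
  rw [← exp_neg_mul_shannonEntropy hn x]
  ring

open Classical in
/-- The reciprocal of the number of strings that have the same joint type with `x` as `y`. -/
noncomputable def invJointCard (x y : Fin n → X) : ℝ :=
  ((Finset.univ.filter fun z : Fin n → X => jointType x z = jointType x y).card : ℝ)⁻¹

theorem invJointCard_nonneg (x y : Fin n → X) : 0 ≤ invJointCard x y := by
  unfold invJointCard; positivity

theorem invJointCard_eq_of_mem {V : X → X → ℝ} {x y : Fin n → X} (hy : y ∈ condTypeClass V x) :
    invJointCard x y = ((condTypeClass V x).ncard : ℝ)⁻¹ := by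
  classical
  rw [condTypeClass_eq_of_mem hy, invJointCard, Set.ncard_eq_toFinset_card']
  congr 3
  ext z
  simp

open Classical in
theorem sum_invJointCard_le (x : Fin n → X) :
    ∑ y, invJointCard x y ≤ (n + 1 : ℝ) ^ (Fintype.card X * Fintype.card X) := by
  have h1 : ∑ y, invJointCard x y = ((Finset.univ.image (jointType x (Y := X))).card : ℝ) := by
    unfold invJointCard
    rw [Finset.sum_comp (fun q => ((Finset.univ.filter fun z : Fin n → X =>
      jointType x z = q).card : ℝ)⁻¹) (jointType x (Y := X)), Finset.cast_card]
    refine Finset.sum_congr rfl fun q hq => ?_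
    obtain ⟨y, -, rfl⟩ := Finset.mem_image.1 hq
    rw [nsmul_eq_mul, mul_inv_cancel₀]
    exact_mod_cast (Finset.card_pos.2 ⟨y, by simp⟩).ne'
  have h2 : (Finset.univ.image (jointType x (Y := X))).card ≤
      (n + 1) ^ (Fintype.card X * Fintype.card X) := by
    calc _ ≤ ((Fintype.piFinset fun _ : X × X => Finset.range (n + 1)).image
          fun c a b => ((c (a, b) : ℕ) : ℝ) / n).card := by
          refine Finset.card_le_card fun q hq => ?_
          obtain ⟨y, -, rfl⟩ := Finset.mem_image.1 hq
          refine Finset.mem_image.2 ⟨fun ab =>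
            (Finset.univ.filter fun i => x i = ab.1 ∧ y i = ab.2).card, ?_, rfl⟩
          rw [Fintype.mem_piFinset]
          intro ab
          rw [Finset.mem_range, Nat.lt_succ_iff]
          exact (Finset.card_le_univ _).trans_eq (Fintype.card_fin n)
      _ ≤ _ := Finset.card_image_le
      _ = _ := by simp
  rw [h1]
  exact_mod_cast h2

/-- Group the permutations by the image of `z`. Each fibre is bounded through the size of the type
class, contributing the exponent `|X|`; the sum of weights over all strings contributes `|X|²`. -/
theorem sum_invJointCard_permuteString_le (hn : n ≠ 0) (x z : Fin n → X) :
    ∑ s : Equiv.Perm (Fin n), invJointCard x (permuteString s z) ≤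
      Fintype.card (Equiv.Perm (Fin n)) *
        ((n + 1 : ℝ) ^ (Fintype.card X * (Fintype.card X + 1)) *
          Real.exp (-(n * shannonEntropy (stringType z)))) := by
  classical
  set A : ℝ := n.factorial * ((n + 1 : ℝ) ^ Fintype.card X *
    Real.exp (-(n * shannonEntropy (stringType z)))) with hA
  calc ∑ s : Equiv.Perm (Fin n), invJointCard x (permuteString s z)
      = ∑ y : Fin n → X, ∑ s : Equiv.Perm (Fin n) with permuteString s z = y,
          invJointCard x (permuteString s z) := (Finset.sum_fiberwise _ _ _).symm
    _ = ∑ y : Fin n → X, (Finset.univ.filter fun s : Equiv.Perm (Fin n) =>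
          permuteString s z = y).card * invJointCard x y := by
        refine Finset.sum_congr rfl fun y _ => ?_
        rw [← nsmul_eq_mul, ← Finset.sum_const]
        exact Finset.sum_congr rfl fun s hs => by rw [(Finset.mem_filter.1 hs).2]
    _ ≤ ∑ y : Fin n → X, A * invJointCard x y := by
        refine Finset.sum_le_sum fun y _ => mul_le_mul_of_nonneg_right ?_ (invJointCard_nonneg x y)
        exact le_trans (by exact_mod_cast card_permuteString_eq_le z y) (prod_factorial_le hn z)
    _ ≤ A * (n + 1 : ℝ) ^ (Fintype.card X * Fintype.card X) := by
        rw [← Finset.mul_sum]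
        exact mul_le_mul_of_nonneg_left (sum_invJointCard_le x) (by positivity)
    _ = _ := by
        rw [hA, Fintype.card_perm, Fintype.card_fin, mul_add, mul_one, pow_add]
        ring

end types

/-! ### Selection of the family of codebooks -/

theorem card_mul_sum_apply {G ι : Type*} [Fintype G] [Fintype ι] [DecidableEq ι] (i : ι)
    (F : G → ℝ) :
    (Fintype.card G : ℝ) * ∑ s : ι → G, F (s i) = Fintype.card (ι → G) * ∑ g, F g := by
  have h := sum_update_swap (ι := ι) i (fun _ (g : G) => F g)
  simp only [Finset.sum_const, Finset.card_univ, nsmul_eq_mul] at h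
  rw [Finset.mul_sum]
  exact h

/-- Expurgation: a random family has small total off-diagonal sum, and discarding the worst rows
turns the average bound into a bound for every row. Removing indices only shrinks the other rows,
because `f` is nonnegative. -/
theorem exists_family_offDiag_le {E : Type*} [Fintype E] [Nonempty E] {f : E → E → ℝ}
    (hf : ∀ a b, 0 ≤ f a b) {c : ℝ} (hc : 0 ≤ c)
    (h : ∀ a, ∑ b, f a b ≤ c * Fintype.card E) {J : ℕ} (hJ : 1 ≤ J) :
    ∃ g : Fin J → E, ∀ j, ∑ l ∈ Finset.univ.erase j, f (g j) (g l) ≤ 4 * (J - 1) * c := by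
  classical
  -- With `2J - 1` draws, fewer than `J` good rows would leave at least `J` bad ones. As `m - 1 =
  -- 2(J - 1)`, the threshold `4(J - 1)c` is twice the bound on the average row, so `J` bad rows
  -- would exceed the total.
  set m := 2 * J - 1 with hm
  have hJ' : (1 : ℝ) ≤ J := by exact_mod_cast hJ
  have hm' : (m : ℝ) = 2 * J - 1 := by
    rw [hm, Nat.cast_sub (by omega)]; push_cast; ring
  have hE : (0 : ℝ) < Fintype.card E := by exact_mod_cast Fintype.card_pos
  have hpair : ∀ j l : Fin m, l ≠ j →
      ∑ g : Fin m → E, f (g j) (g l) ≤ c * Fintype.card (Fin m → E) := by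
    intro j l hlj
    have hsw := sum_update_swap (ι := Fin m) l (fun g b => f (g j) b)
    simp only [Function.update_of_ne hlj.symm, Finset.sum_const, Finset.card_univ,
      nsmul_eq_mul] at hsw
    refine le_of_mul_le_mul_left ?_ hE
    rw [Finset.mul_sum, hsw]
    calc _ ≤ ∑ _g : Fin m → E, c * Fintype.card E := Finset.sum_le_sum fun g _ => h _
      _ = _ := by rw [Finset.sum_const, Finset.card_univ, nsmul_eq_mul]; ring
  obtain ⟨g, -, hg⟩ : ∃ g ∈ (Finset.univ : Finset (Fin m → E)),
      ∑ j, ∑ l ∈ Finset.univ.erase j, f (g j) (g l) ≤ m * ((m - 1) * c) := by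
    refine Finset.exists_le_of_sum_le Finset.univ_nonempty ?_
    rw [Finset.sum_comm]
    calc _ ≤ ∑ _j : Fin m, (m - 1) * c * Fintype.card (Fin m → E) := by
          refine Finset.sum_le_sum fun j _ => ?_
          rw [Finset.sum_comm]
          calc _ ≤ ∑ _l ∈ Finset.univ.erase j, c * Fintype.card (Fin m → E) :=
                Finset.sum_le_sum fun l hl => hpair j l (Finset.ne_of_mem_erase hl)
            _ = _ := by
                rw [Finset.sum_const, Finset.card_erase_of_mem (Finset.mem_univ j), nsmul_eq_mul,
                  Finset.card_univ, Fintype.card_fin, Nat.cast_sub (by omega)]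
                push_cast; ring
      _ = _ := by
          simp only [Finset.sum_const, Finset.card_univ, Fintype.card_fin, nsmul_eq_mul]
          ring
  set row : Fin m → ℝ := fun j => ∑ l ∈ Finset.univ.erase j, f (g j) (g l) with hrow
  have hrow0 : ∀ j, 0 ≤ row j := fun j => Finset.sum_nonneg fun l _ => hf _ _
  set good := Finset.univ.filter fun j => row j ≤ 4 * (J - 1) * c with hgood
  have hcard : J ≤ good.card := by
    by_contra hlt
    set bad := Finset.univ.filter fun j => ¬ row j ≤ 4 * (J - 1) * c with hbad
    have hadd : good.card + bad.card = m := by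
      have := Finset.card_filter_add_card_filter_not (s := (Finset.univ : Finset (Fin m)))
        (fun j => row j ≤ 4 * (J - 1) * c)
      rw [Finset.card_univ, Fintype.card_fin] at this
      convert this
    have hbc : J ≤ bad.card := by omega
    have hne : bad.Nonempty := Finset.card_pos.1 (by omega)
    have h1 : ∑ _j ∈ bad, 4 * (J - 1) * c < ∑ j ∈ bad, row j :=
      Finset.sum_lt_sum_of_nonempty hne fun j hj => not_le.1 (Finset.mem_filter.1 hj).2
    have h2 : ∑ j ∈ bad, row j ≤ ∑ j, row j :=
      Finset.sum_le_sum_of_subset_of_nonneg (Finset.subset_univ _) fun j _ _ => hrow0 j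
    rw [Finset.sum_const, nsmul_eq_mul] at h1
    have hbc' : (J : ℝ) ≤ bad.card := by exact_mod_cast hbc
    have hnn : 0 ≤ 4 * ((J : ℝ) - 1) * c := by
      have : 0 ≤ (J : ℝ) - 1 := by linarith
      positivity
    have h3 := mul_le_mul_of_nonneg_right hbc' hnn
    rw [hm'] at hg
    have h4 : 0 ≤ (J - 1 : ℝ) * c := mul_nonneg (by linarith) hc
    nlinarith
  obtain ⟨σ⟩ : Nonempty (Fin J ↪ good) := by
    rw [Function.Embedding.nonempty_iff_card_le]
    simpa using hcard
  refine ⟨fun j => g (σ j), fun j => ?_⟩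
  have hj := (Finset.mem_filter.1 (σ j).2).2
  refine le_trans ?_ hj
  have hinj : Function.Injective fun l => ((σ l : good) : Fin m) :=
    Subtype.val_injective.comp σ.injective
  calc ∑ l ∈ Finset.univ.erase j, f (g (σ j)) (g (σ l))
      = ∑ l' ∈ (Finset.univ.erase j).image fun l => ((σ l : good) : Fin m), f (g (σ j)) (g l') :=
        by rw [Finset.sum_image (fun a _ b _ hab => hinj hab)]
    _ ≤ _ := by
        refine Finset.sum_le_sum_of_subset_of_nonneg (fun l' hl' => ?_) fun _ _ _ => hf _ _
        obtain ⟨l, hl, rfl⟩ := Finset.mem_image.1 hl'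
        exact Finset.mem_erase.2
          ⟨fun he => Finset.ne_of_mem_erase hl (hinj he), Finset.mem_univ _⟩

/-! ### Weights between codebooks and their averages. -/

/-- The total weight `∑ w x y` over pairs of elements of two multisets. -/
def pairWeight {A : Type*} (w : A → A → ℝ) (M N : Multiset A) : ℝ :=
  (M.map fun x => (N.map (w x)).sum).sum

theorem pairWeight_nonneg {A : Type*} {w : A → A → ℝ} (hw : ∀ x y, 0 ≤ w x y) (M N : Multiset A) :
    0 ≤ pairWeight w M N := by
  refine Multiset.sum_nonneg fun a ha => ?_
  obtain ⟨x, -, rfl⟩ := Multiset.mem_map.1 ha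
  refine Multiset.sum_nonneg fun b hb => ?_
  obtain ⟨y, -, rfl⟩ := Multiset.mem_map.1 hb
  exact hw x y

theorem pairWeight_sum_right {A ι : Type*} (w : A → A → ℝ) (M : Multiset A) (T : Finset ι)
    (N : ι → Multiset A) : pairWeight w M (∑ l ∈ T, N l) = ∑ l ∈ T, pairWeight w M (N l) := by
  classical
  induction T using Finset.induction_on with
  | empty => simp [pairWeight]
  | insert a T ha ih =>
    rw [Finset.sum_insert ha, Finset.sum_insert ha, ← ih]
    simp [pairWeight, Multiset.sum_map_add]

theorem sum_pairWeight_le {A E : Type*} [Fintype E] (w : A → A → ℝ) (M : Multiset A)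
    (N : E → Multiset A) (c : ℝ) (h : ∀ x, ∑ b, ((N b).map (w x)).sum ≤ c) :
    ∑ b, pairWeight w M (N b) ≤ M.card * c := by
  induction M using Multiset.induction_on with
  | empty => simp [pairWeight]
  | cons a M ih =>
    simp only [pairWeight, Multiset.map_cons, Multiset.sum_cons, Finset.sum_add_distrib,
      Multiset.card_cons] at ih ⊢
    push_cast
    linarith [h a]

open Classical in
theorem card_filter_lt_mul_le {A : Type*} (M : Multiset A) {W : A → ℝ} (hW : ∀ x, 0 ≤ W x)
    (t : ℝ) : ((M.filter fun x => t < W x).card : ℝ) * t ≤ (M.map W).sum := by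
  induction M using Multiset.induction_on with
  | empty => simp
  | cons a M ih =>
    rw [Multiset.filter_cons, Multiset.card_add, Multiset.map_cons, Multiset.sum_cons]
    split_ifs with h
    · simp only [Multiset.card_singleton]; push_cast; linarith
    · simp only [Multiset.card_zero]; push_cast; linarith [hW a]

/-- The codebook obtained by moving `x` by the entries of a tuple and their inverses. -/
def orbitCodebook {X : Type*} {n k : ℕ} (x : Fin n → X) (s : Fin k → Equiv.Perm (Fin n)) :
    Multiset (Fin n → X) :=
  (symmetrization s).map fun t => permuteString t x

theorem card_orbitCodebook {X : Type*} {n k : ℕ} (x : Fin n → X) (s : Fin k → Equiv.Perm (Fin n)) :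
    (orbitCodebook x s).card = 2 * k := by
  rw [orbitCodebook, Multiset.card_map, card_symmetrization, Fintype.card_fin]

section codebooks

variable {X : Type*} [Fintype X] {n : ℕ}

theorem sum_orbitCodebook_le {k : ℕ} [DecidableEq X] (hn : n ≠ 0) (x z : Fin n → X) :
    ∑ s : Fin k → Equiv.Perm (Fin n), ((orbitCodebook z s).map (invJointCard x)).sum ≤
      2 * k * (Fintype.card (Fin k → Equiv.Perm (Fin n)) *
        ((n + 1 : ℝ) ^ (Fintype.card X * (Fintype.card X + 1)) *
          Real.exp (-(n * shannonEntropy (stringType z))))) := by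
  set η : ℝ := (n + 1 : ℝ) ^ (Fintype.card X * (Fintype.card X + 1)) *
    Real.exp (-(n * shannonEntropy (stringType z))) with hη
  have hG : (0 : ℝ) < Fintype.card (Equiv.Perm (Fin n)) := by exact_mod_cast Fintype.card_pos
  have hbound := sum_invJointCard_permuteString_le hn x z
  rw [← hη] at hbound
  have key : ∀ F : Equiv.Perm (Fin n) → ℝ, ∑ g, F g ≤ Fintype.card (Equiv.Perm (Fin n)) * η →
      ∀ i : Fin k, ∑ s : Fin k → Equiv.Perm (Fin n), F (s i) ≤
        Fintype.card (Fin k → Equiv.Perm (Fin n)) * η := by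
    intro F hF i
    refine le_of_mul_le_mul_left ?_ hG
    rw [card_mul_sum_apply]
    calc _ ≤ (Fintype.card (Fin k → Equiv.Perm (Fin n)) : ℝ) *
          (Fintype.card (Equiv.Perm (Fin n)) * η) := by gcongr
      _ = _ := by ring
  have h1 := key (fun g => invJointCard x (permuteString g z)) hbound
  have h2 := key (fun g => invJointCard x (permuteString g⁻¹ z))
    ((Equiv.sum_comp (Equiv.inv _) fun g => invJointCard x (permuteString g z)).trans_le hbound)
  calc _ = ∑ s : Fin k → Equiv.Perm (Fin n), ∑ i, (invJointCard x (permuteString (s i) z) +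
        invJointCard x (permuteString (s i)⁻¹ z)) := by
        refine Finset.sum_congr rfl fun s _ => ?_
        rw [Finset.sum_add_distrib]
        simp only [orbitCodebook, symmetrization, Multiset.map_add, Multiset.map_map,
          Multiset.sum_add]
        rfl
    _ = ∑ i : Fin k, ∑ s : Fin k → Equiv.Perm (Fin n),
        (invJointCard x (permuteString (s i) z) +
          invJointCard x (permuteString (s i)⁻¹ z)) := Finset.sum_comm
    _ ≤ ∑ _i : Fin k, (Fintype.card (Fin k → Equiv.Perm (Fin n)) * η +
          Fintype.card (Fin k → Equiv.Perm (Fin n)) * η) := by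
        refine Finset.sum_le_sum fun i _ => ?_
        rw [Finset.sum_add_distrib]
        exact add_le_add (h1 i) (h2 i)
    _ = _ := by
        rw [Finset.sum_const, Finset.card_univ, Fintype.card_fin, nsmul_eq_mul]
        ring

open Classical in
theorem exists_expanding_family [DecidableEq X] (hn : n ≠ 0) (x : Fin n → X) {k J p : ℕ} {t : ℝ}
    (hk : k ≠ 0) (ht : 0 < t) (hp : p ≠ 0) (hpt : 4 * p ≤ k * t ^ 2)
    (hV : 2 * (Fintype.card X : ℝ) ^ n ≤ 2 ^ p) (hJ : 1 ≤ J) :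
    ∃ s : Fin J → Fin k → Equiv.Perm (Fin n),
      (∀ j, schreierLambda (isotropy x) (isSymmetricMultiset_symmetrization (s j)) ≤ t) ∧
      ∀ j, pairWeight invJointCard (orbitCodebook x (s j))
          (∑ l ∈ Finset.univ.erase j, orbitCodebook x (s l)) ≤
        8 * (2 * k * ((2 * k) * (J - 1))) *
          ((n + 1 : ℝ) ^ (Fintype.card X * (Fintype.card X + 1)) *
            Real.exp (-(n * shannonEntropy (stringType x)))) := by
  have : NeZero k := ⟨hk⟩
  set η : ℝ := (n + 1 : ℝ) ^ (Fintype.card X * (Fintype.card X + 1)) *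
    Real.exp (-(n * shannonEntropy (stringType x))) with hη
  have hη0 : 0 ≤ η := by positivity
  have hhalf := card_le_two_mul_card_expanding (ι := Fin k) (isotropy x) ht hp (by simpa using hpt)
    (le_trans (by gcongr; exact_mod_cast card_quotient_isotropy_le x) hV)
  let E := {s : Fin k → Equiv.Perm (Fin n) //
    schreierLambda (isotropy x) (isSymmetricMultiset_symmetrization s) ≤ t}
  have hcardE : (Fintype.card (Fin k → Equiv.Perm (Fin n)) : ℝ) ≤ 2 * Fintype.card E := by
    have : Fintype.card (Fin k → Equiv.Perm (Fin n)) ≤ 2 * Fintype.card E := by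
      rw [Fintype.card_subtype]
      convert hhalf
    exact_mod_cast this
  have hE : Nonempty E := by
    rw [← Fintype.card_pos_iff]
    have : (0 : ℝ) < Fintype.card (Fin k → Equiv.Perm (Fin n)) := by
      exact_mod_cast Fintype.card_pos
    have : (0 : ℝ) < Fintype.card E := by linarith
    exact_mod_cast this
  obtain ⟨g, hg⟩ := exists_family_offDiag_le (E := E)
    (f := fun a b => pairWeight invJointCard (orbitCodebook x a.1) (orbitCodebook x b.1))
    -- The leading 2 is the cost of averaging over expanding tuples only, which are at least half of
    -- all tuples.
    (fun a b => pairWeight_nonneg invJointCard_nonneg _ _) (c := 2 * (2 * k * (2 * k) * η))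
    (by positivity) (fun a => by
      refine (sum_pairWeight_le _ _ _ (2 * k * (2 * Fintype.card E * η)) fun y => ?_).trans_eq ?_
      · calc ∑ b : E, ((orbitCodebook x b.1).map (invJointCard y)).sum
            = ∑ s : Fin k → Equiv.Perm (Fin n) with
                schreierLambda (isotropy x) (isSymmetricMultiset_symmetrization s) ≤ t,
                ((orbitCodebook x s).map (invJointCard y)).sum :=
              (Finset.sum_subtype (p := fun s =>
                schreierLambda (isotropy x) (isSymmetricMultiset_symmetrization s) ≤ t)
                _ (fun s => Finset.mem_filter_univ s)
                (fun s => ((orbitCodebook x s).map (invJointCard y)).sum)).symm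
          _ ≤ ∑ s : Fin k → Equiv.Perm (Fin n), ((orbitCodebook x s).map (invJointCard y)).sum := by
              refine Finset.sum_le_sum_of_subset_of_nonneg (Finset.subset_univ _) fun s _ _ => ?_
              refine Multiset.sum_nonneg fun r hr => ?_
              obtain ⟨z, -, rfl⟩ := Multiset.mem_map.1 hr
              exact invJointCard_nonneg y z
          _ ≤ _ := by
              refine (sum_orbitCodebook_le hn y x).trans ?_
              rw [← hη]
              gcongr
      · rw [card_orbitCodebook]; push_cast; ring) hJ
  refine ⟨fun j => (g j).1, fun j => (g j).2, fun j => ?_⟩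
  rw [pairWeight_sum_right]
  refine (hg j).trans_eq (by ring)

end codebooks

/-- The exceptional set consists of the strings whose total weight against the other codebooks
exceeds `ε⁻¹ e`, and Markov's inequality bounds its size. For any other string, each competitor in
`T_V(x)` has weight `1 / |T_V(x)|`, so the total weight controls the count for every `V` at once. -/
theorem isSetwiseGoodCodebook_of_pairWeight_le {X : Type*} [Fintype X] [LinearOrder X] {n : ℕ}
    {P : X → ℝ} {R δ : ℝ} {K J : ℕ} {𝒦 : Fin J → Multiset (Fin n → X)} (hP : IsStringType n P)
    (hR : 0 < R) (hRH : R < shannonEntropy P) (hδ : 0 < δ) (hcard : ∀ j, (𝒦 j).card = K)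
    (htype : ∀ j, ∀ x ∈ 𝒦 j, stringType x = P)
    (hsize : (K : ℝ) * ((J : ℝ) - 1) = Real.exp (n * R - δ)) {C : ℝ}
    (hrow : ∀ j, pairWeight invJointCard (𝒦 j) (∑ l ∈ Finset.univ.erase j, 𝒦 l) ≤
      C * K * Real.exp (-(n * (shannonEntropy P - R)))) {ε : ℝ} (hε : 0 < ε) :
    IsSetwiseGoodCodebook (C * ε) ε⁻¹ P R δ K J 𝒦 := by
  classical
  have hdiff : ∀ j, (∑ l, 𝒦 l) - 𝒦 j = ∑ l ∈ Finset.univ.erase j, 𝒦 l := fun j => by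
    rw [← Finset.add_sum_erase _ _ (Finset.mem_univ j), add_tsub_cancel_left]
  refine ⟨hP, hR, hRH, hδ, hcard, ?_, fun j => ?_, hsize, fun j => ?_⟩
  · intro x hx
    obtain ⟨l, -, hl⟩ := Multiset.mem_sum.1 hx
    exact htype l x hl
  · have hJ : 1 ≤ J := by have := j.2; omega
    rw [hdiff, Multiset.card_sum, Finset.sum_congr rfl fun l _ => hcard l, Finset.sum_const,
      Finset.card_erase_of_mem (Finset.mem_univ j), Finset.card_univ, Fintype.card_fin,
      smul_eq_mul, Nat.cast_mul, Nat.cast_sub hJ, Nat.cast_one, mul_comm]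
  · set D := ∑ l ∈ Finset.univ.erase j, 𝒦 l with hD
    set e := Real.exp (-(n * (shannonEntropy P - R))) with he
    have he0 : 0 < e := Real.exp_pos _
    set W : (Fin n → X) → ℝ := fun x => (D.map (invJointCard x)).sum with hW
    have hW0 : ∀ x, 0 ≤ W x := fun x => Multiset.sum_nonneg fun r hr => by
      obtain ⟨y, -, rfl⟩ := Multiset.mem_map.1 hr
      exact invJointCard_nonneg x y
    refine ⟨(𝒦 j).filter fun x => ε⁻¹ * e < W x, Multiset.filter_le _ _, ?_, ?_⟩
    · have h1 := card_filter_lt_mul_le (𝒦 j) hW0 (ε⁻¹ * e)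
      have h2 := h1.trans (hrow j)
      have h3 : (0 : ℝ) < ε⁻¹ * e := by positivity
      refine le_of_mul_le_mul_right ?_ h3
      calc _ ≤ C * K * e := by convert h2
        _ = _ := by field_simp
    · intro x hx V _
      have hx' : W x ≤ ε⁻¹ * e := by
        have hsub : (𝒦 j) - (𝒦 j).filter (fun x => ε⁻¹ * e < W x) =
            (𝒦 j).filter fun x => ¬ ε⁻¹ * e < W x := by
          have hadd := Multiset.filter_add_not (fun x => ε⁻¹ * e < W x) (𝒦 j)
          exact tsub_eq_of_eq_add_rev hadd.symm
        have hx2 : x ∈ (𝒦 j) - (𝒦 j).filter (fun x => ε⁻¹ * e < W x) := by convert hx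
        rw [hsub] at hx2
        exact not_lt.1 (Multiset.mem_filter.1 hx2).2
      rw [hdiff, ← hD]
      have hcount : ∀ N : Multiset (Fin n → X),
          ((N.countP fun y => y ∈ condTypeClass V x : ℕ) : ℝ) ≤
            ((condTypeClass V x).ncard : ℝ) * (N.map (invJointCard x)).sum := by
        intro N
        induction N using Multiset.induction_on with
        | empty => simp
        | cons y N ih =>
          rw [Multiset.countP_cons, Multiset.map_cons, Multiset.sum_cons, mul_add]
          split_ifs with hy
          · have hpos : (0 : ℝ) < (condTypeClass V x).ncard := by
              exact_mod_cast (Set.ncard_pos (Set.toFinite _)).2 ⟨y, hy⟩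
            rw [invJointCard_eq_of_mem hy, mul_inv_cancel₀ hpos.ne']
            push_cast
            linarith
          · have := invJointCard_nonneg x y
            have : 0 ≤ ((condTypeClass V x).ncard : ℝ) * invJointCard x y := by positivity
            push_cast
            linarith
      calc _ ≤ ((condTypeClass V x).ncard : ℝ) * W x := by convert hcount D
        _ ≤ ((condTypeClass V x).ncard : ℝ) * (ε⁻¹ * e) := by gcongr
        _ = _ := by ring

/-! ### Choice of the parameters. -/

theorem exists_forall_mul_exp_mul_pow_le {a b : ℝ} (hab : a < b) (A : ℝ) (hA : 0 ≤ A) (c : ℕ) :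
    ∃ N : ℕ, ∀ n : ℕ, N ≤ n →
      A * n * Real.exp (n * a) * (n + 1 : ℝ) ^ c ≤ Real.exp (n * b) := by
  have hlo := (isLittleO_pow_exp_pos_mul_atTop (k := c + 1) (sub_pos.2 hab)).comp_tendsto
    tendsto_natCast_atTop_atTop
  have hpos : 0 < (A * 2 ^ c + 1)⁻¹ := by positivity
  obtain ⟨N, hN⟩ := Filter.eventually_atTop.1 (hlo.def hpos)
  refine ⟨max N 1, fun n hn => ?_⟩
  have h1 : (1 : ℝ) ≤ n := by exact_mod_cast (le_max_right N 1).trans hn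
  have h2 := hN n ((le_max_left N 1).trans hn)
  simp only [Function.comp_apply, Real.norm_eq_abs, Real.abs_exp] at h2
  rw [abs_of_nonneg (by positivity), le_inv_mul_iff₀ (by positivity)] at h2
  have h3 : (n + 1 : ℝ) ^ c ≤ 2 ^ c * (n : ℝ) ^ c := by
    rw [← mul_pow]
    exact pow_le_pow_left₀ (by positivity) (by linarith) c
  have h4 : A * n * (n + 1 : ℝ) ^ c ≤ Real.exp ((b - a) * n) := by
    calc A * n * (n + 1 : ℝ) ^ c ≤ A * n * (2 ^ c * (n : ℝ) ^ c) := by gcongr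
      _ = (A * 2 ^ c) * (n : ℝ) ^ (c + 1) := by ring
      _ ≤ (A * 2 ^ c + 1) * (n : ℝ) ^ (c + 1) := by gcongr; linarith
      _ ≤ _ := h2
  calc _ = A * n * (n + 1 : ℝ) ^ c * Real.exp (n * a) := by ring
    _ ≤ Real.exp ((b - a) * n) * Real.exp (n * a) := by gcongr
    _ = _ := by rw [← Real.exp_add]; congr 1; ring

theorem one_lt_card_of_shannonEntropy_pos {X : Type*} [Fintype X] [DecidableEq X] {n : ℕ}
    (hn : n ≠ 0) (x : Fin n → X) (h : 0 < shannonEntropy (stringType x)) :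
    1 < Fintype.card X := by
  by_contra hle
  have hsub : Subsingleton X := Fintype.card_le_one_iff_subsingleton.1 (not_lt.1 hle)
  have h1 : ∀ a, stringType x a = 1 := fun a => by
    have hn' : (n : ℝ) ≠ 0 := by exact_mod_cast hn
    simp [stringType, Subsingleton.elim _ a, hn']
  simp [shannonEntropy, h1] at h

theorem exists_moment_order {q n k : ℕ} {R : ℝ} (hq : 2 ≤ q) (hn : 100 ≤ n) (hR : 0 < R)
    (hk : 6 * (n * Real.log q) * Real.exp (n * R) - 1 ≤ k) :
    ∃ p : ℕ, p ≠ 0 ∧ 4 * p ≤ k * Real.exp (-(n * R / 2)) ^ 2 ∧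
      2 * (q : ℝ) ^ n ≤ 2 ^ p := by
  have hlog2 := Real.log_two_gt_d9
  have hq' : (2 : ℝ) ≤ q := by exact_mod_cast hq
  have hn' : (100 : ℝ) ≤ n := by exact_mod_cast hn
  have hlogq : Real.log 2 ≤ Real.log q := Real.log_le_log (by norm_num) hq'
  set L := (n : ℝ) * Real.log q with hL
  have hL69 : 69 ≤ L := by nlinarith
  have h2 : 0 < Real.log 2 := by linarith
  -- The ceiling gives `2 ^ p ≥ q ^ n` and the extra 1 absorbs the factor 2. Since `4 / log 2` is
  -- about 5.77, below 6, the gap covers all rounding losses once `L ≥ 69`.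
  refine ⟨⌈L / Real.log 2⌉₊ + 1, by omega, ?_, ?_⟩
  · have hceil := Nat.ceil_lt_add_one (a := L / Real.log 2) (by positivity)
    have hdiv : L / Real.log 2 ≤ 1.443 * L := by
      rw [div_le_iff₀ h2]; nlinarith
    have hsq : Real.exp (-(n * R / 2)) ^ 2 = Real.exp (-(n * R)) := by
      rw [← Real.exp_nat_mul]; congr 1; push_cast; ring
    have hle1 : Real.exp (-(n * R)) ≤ 1 := by
      rw [Real.exp_le_one_iff]
      have : 0 ≤ (n : ℝ) * R := by positivity
      linarith
    have hk2 : (6 * L * Real.exp (n * R) - 1) * Real.exp (-(n * R)) ≤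
        k * Real.exp (-(n * R)) := by gcongr
    have hmul : (6 * L * Real.exp (n * R) - 1) * Real.exp (-(n * R)) =
        6 * L - Real.exp (-(n * R)) := by
      rw [sub_mul, mul_assoc, ← Real.exp_add, add_neg_cancel, Real.exp_zero, mul_one, one_mul]
    rw [hsq]
    push_cast
    linarith
  · have hceil := Nat.le_ceil (L / Real.log 2)
    rw [div_le_iff₀ h2] at hceil
    have hqn : (q : ℝ) ^ n = Real.exp L := by
      rw [hL, Real.exp_nat_mul, Real.exp_log (by linarith)]
    have htwo : (2 : ℝ) ^ ⌈L / Real.log 2⌉₊ = Real.exp (⌈L / Real.log 2⌉₊ * Real.log 2) := by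
      rw [Real.exp_nat_mul, Real.exp_log two_pos]
    rw [pow_succ', hqn, htwo]
    have := Real.exp_le_exp.2 hceil
    linarith

theorem mainTheorem5 {X : Type*} [Fintype X] [LinearOrder X] (RE RB : ℝ)
    (hRE : 0 < RE) (hRB : RE < RB) :
    ∃ N : ℕ, ∀ n : ℕ, N ≤ n → ∀ P : X → ℝ, IsStringType n P → RB < shannonEntropy P →
      ∃ (K J : ℕ) (𝒦 : Fin J → Multiset (Fin n → X)) (δ₁ δ₂ : ℝ),
        (∀ j, (𝒦 j).card = K) ∧
        δ₂ ≤ Real.log (12 * n * Real.log (Fintype.card X)) ∧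
        (∀ j, IsRadicalSpectralExpander P RE δ₂ (𝒦 j)) ∧
        Real.log ((n + 1 : ℝ) ^ (Fintype.card X * (Fintype.card X + 1))) ≤ δ₁ ∧
        δ₁ < Real.log ((n + 1 : ℝ) ^ (Fintype.card X * (Fintype.card X + 1))) +
          Real.log ((J : ℝ) / ((J : ℝ) - 1)) ∧
        ∀ ε : ℝ, 0 < ε → IsSetwiseGoodCodebook (16 * ε) ε⁻¹ P RB δ₁ K J 𝒦 := by
  set q := Fintype.card X with hq
  set c := q * (q + 1) with hc
  obtain ⟨N, hN⟩ := exists_forall_mul_exp_mul_pow_le hRB (12 * Real.log q)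
    (mul_nonneg (by norm_num) (Real.log_natCast_nonneg q)) c
  refine ⟨max N 100, fun n hn P hP hPH => ?_⟩
  have hn100 : 100 ≤ n := (le_max_right N 100).trans hn
  have hnR : (100 : ℝ) ≤ n := by exact_mod_cast hn100
  have hn0 : n ≠ 0 := by omega
  have hNn := hN n ((le_max_left N 100).trans hn)
  obtain ⟨x₀, hx₀⟩ := hP
  obtain ⟨x, hxmono, hx⟩ : ∃ x : Fin n → X, Monotone x ∧ stringType x = P :=
    ⟨x₀ ∘ Tuple.sort x₀, Tuple.monotone_sort x₀, by
      rw [← hx₀, ← stringType_permuteString (Tuple.sort x₀)⁻¹ x₀]; rfl⟩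
  have hq2 : 2 ≤ q := one_lt_card_of_shannonEntropy_pos hn0 x (by rw [hx]; linarith)
  have hlogq : Real.log 2 ≤ Real.log q := Real.log_le_log two_pos (by exact_mod_cast hq2)
  have hlog2 := Real.log_two_gt_d9
  set L := (n : ℝ) * Real.log q with hL
  have hL69 : 69 ≤ L := by nlinarith
  set e := Real.exp (n * RE) with he
  have he1 : 1 ≤ e := Real.one_le_exp (by positivity)
  -- A codebook has `2 * k` elements, so the bound `12 * L * e` on its size is the one required of
  -- `δ₂`, while `k t²` stays close enough to `6 * L` for the moment method.
  set k := ⌊6 * L * e⌋₊ with hk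
  have hLe : 69 * e ≤ L * e := by gcongr
  have hkle : (k : ℝ) ≤ 6 * L * e := Nat.floor_le (by positivity)
  have hkge : 6 * L * e - 1 < k := by linarith [Nat.lt_floor_add_one (6 * L * e)]
  have hkpos : (0 : ℝ) < k := by linarith
  have hk0 : k ≠ 0 := by rintro h; rw [h] at hkpos; simp at hkpos
  set B := Real.exp (n * RB) / (n + 1 : ℝ) ^ c with hB
  have hB0 : 0 < B := by positivity
  have hKB : 2 * (k : ℝ) ≤ B := by
    rw [hB, le_div_iff₀ (by positivity)]
    refine le_trans ?_ hNn
    refine mul_le_mul_of_nonneg_right ?_ (by positivity)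
    calc 2 * (k : ℝ) ≤ 2 * (6 * L * e) := by gcongr
      _ = _ := by rw [hL]; ring
  -- This is `J - 1`, the largest integer with `K (J - 1) ≤ B`; the two inequalities of the floor
  -- give the two ends of the range of `δ₁`. The gap `RE < RB` makes it at least 1 for large `n`.
  set m := ⌊B / (2 * k)⌋₊ with hm
  have hm1 : 1 ≤ m := by
    rw [hm, Nat.one_le_floor_iff, le_div_iff₀ (by positivity)]
    linarith
  have hm1' : (1 : ℝ) ≤ m := by exact_mod_cast hm1
  have hmle : 2 * (k : ℝ) * m ≤ B := by
    have := Nat.floor_le (a := B / (2 * k)) (by positivity)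
    rw [le_div_iff₀ (by positivity)] at this
    linarith
  have hmgt : B < 2 * (k : ℝ) * (m + 1) := by
    have := Nat.lt_floor_add_one (B / (2 * k))
    rw [div_lt_iff₀ (by positivity)] at this
    linarith
  obtain ⟨p, hp, hpk, hpq⟩ := exists_moment_order (R := RE) hq2 hn100 hRE hkge.le
  obtain ⟨s, hs, hrow⟩ := exists_expanding_family hn0 x (J := m + 1) hk0 (Real.exp_pos _) hp hpk
    (by rw [← hq]; exact hpq) (by omega)
  have hJ : ((m + 1 : ℕ) : ℝ) - 1 = m := by push_cast; ring
  have hK : ((2 * k : ℕ) : ℝ) = 2 * k := by push_cast; ring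
  have hlogB : Real.log B = n * RB - Real.log ((n + 1 : ℝ) ^ c) := by
    rw [hB, Real.log_div (by positivity) (by positivity), Real.log_exp]
  have hKm : 0 < 2 * (k : ℝ) * m := by positivity
  have hδ₁ : Real.log ((n + 1 : ℝ) ^ c) ≤ n * RB - Real.log (2 * k * m) := by
    have := Real.log_le_log hKm hmle
    linarith
  refine ⟨2 * k, m + 1, fun j => orbitCodebook x (s j), n * RB - Real.log (2 * k * m),
    Real.log (2 * k) - n * RE, fun j => card_orbitCodebook x (s j), ?_, fun j => ?_, hδ₁, ?_,
    fun ε hε => ?_⟩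
  · have : Real.log (2 * k) ≤ Real.log (12 * n * Real.log q * e) :=
      Real.log_le_log (by positivity) (by rw [mul_assoc 12, ← hL]; linarith)
    rw [Real.log_mul (x := 12 * n * Real.log q) (by rw [mul_assoc 12, ← hL]; positivity)
      (by positivity), he, Real.log_exp] at this
    linarith
  · refine ⟨⟨x, hx⟩, hRE, hRB.trans hPH, ?_, x, hxmono, hx, symmetrization (s j),
      isSymmetricMultiset_symmetrization (s j), rfl, ?_, ?_, hs j⟩
    · have : Real.log e < Real.log (2 * k) := Real.log_lt_log (by positivity) (by linarith)
      rw [he, Real.log_exp] at this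
      linarith
    · rw [card_orbitCodebook, card_symmetrization, Fintype.card_fin]
    · rw [card_symmetrization, Fintype.card_fin, add_sub_cancel, Real.exp_log (by positivity), hK]
  · rw [hJ]
    have h1 : Real.log B < Real.log (2 * k * (m + 1)) := Real.log_lt_log hB0 hmgt
    have h2 : Real.log (2 * k * (m + 1)) =
        Real.log (2 * k * m) + Real.log (((m + 1 : ℕ) : ℝ) / m) := by
      rw [← Real.log_mul (by positivity) (by positivity)]
      congr 1
      push_cast
      field_simp
    linarith
  · refine isSetwiseGoodCodebook_of_pairWeight_le ⟨x, hx⟩ (hRE.trans hRB) hPH ?_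
      (fun j => card_orbitCodebook x (s j)) (fun j y hy => ?_) ?_ (fun j => ?_) hε
    · refine lt_of_lt_of_le (Real.log_pos (one_lt_pow₀ (by linarith) ?_)) hδ₁
      rw [hc]
      positivity
    · obtain ⟨t, -, rfl⟩ := Multiset.mem_map.1 hy
      rw [stringType_permuteString, hx]
    · rw [hJ, hK, sub_sub_cancel, Real.exp_log hKm]
    · refine (hrow j).trans ?_
      rw [hJ, hK, hx, ← hq, ← hc]
      have h1 : 2 * (k : ℝ) * m * (n + 1 : ℝ) ^ c ≤ Real.exp (n * RB) := by
        rwa [hB, le_div_iff₀ (by positivity)] at hmle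
      have h2 : Real.exp (n * RB) * Real.exp (-(n * shannonEntropy P)) =
          Real.exp (-(n * (shannonEntropy P - RB))) := by
        rw [← Real.exp_add]; congr 1; ring
      calc 8 * (2 * (k : ℝ) * (2 * k * m)) * ((n + 1 : ℝ) ^ c * Real.exp (-(n * shannonEntropy P)))
          = 8 * (2 * k) * (2 * k * m * (n + 1 : ℝ) ^ c) * Real.exp (-(n * shannonEntropy P)) := by
            ring
        -- The argument yields 8, that is 4 from expurgation times 2 from conditioning on expansion;
        -- 16 is slack.
        _ ≤ 16 * (2 * k) * Real.exp (n * RB) * Real.exp (-(n * shannonEntropy P)) := by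
            gcongr
            norm_num
        _ = _ := by rw [mul_assoc, h2]
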